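/- Let $\mathbb D$ be the open unit disc, $H^\infty$ the Banach algebra of bounded holomorphic functions on $\mathbb D$ with the supremum norm, and $\mathcal M$ its maximal ideal space (the nonzero multiplicative linear functionals on $H^\infty$, with the weak-star topology); $\mathbb D$ is regarded as a subset of $\mathcal M$ through point evaluations. Let $\pi(x)=x(\mathrm{id}_{\mathbb D})$ for $x\in\mathcal M$, where $\mathrm{id}_{\mathbb D}(z)=z$. For $w,z\in\mathbb D$ put $L_w(z)=\frac{z+w}{1+\overline w z}$, and for $m\in\mathcal M$ let $L_m:\mathbb D\to\mathcal M$ be the Hoffman map, $L_m(z)=\lim_\alpha L_{w_\alpha}(z)$ for any net $(w_\alpha)$ in $\mathbb D$ with $w_\alpha\to m$. It satisfies $f\circ L_m\in H^\infty$ for all $f\in H^\infty$, and it is extended to a map $L_m:\mathcal M\to\mathcal M$ by $L_m(\varphi)(f)=\varphi(f\circ L_m)$. For $x,y\in\mathcal M$ let $$\lambda(x,y)=\lim_\alpha\frac{1+\overline{\pi(x)}\,z_\alpha}{1+\pi(x)\,\overline{z_\alpha}}\in\partial\mathbb D ,$$ where $(z_\alpha)$ is any net in $\mathbb D$ that tends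 to $y$. A set $S\subset\mathbb D$ is (the set of terms of) an interpolating sequence if $\sum_{z\in S}(1-|z|)<\infty$ and $\inf_{z\in S}\prod_{w\in S,\,w\ne z}\left|\frac{z-w}{1-\overline w z}\right|>0$; let $\mathcal G$ be the set of points of $\mathcal M$ that lie in the closure of some interpolating sequence. Lemma. Let $m\in\mathcal G$. Then for every $\omega\in\mathbb D$, $$\{\xi\in\mathcal M: L_m(\xi)=L_m(\omega)\}=\{\,L_x(\lambda(m,x)\,\omega)\;:\;x\in\mathcal M,\ L_m(x)=m\,\}.$$ -/

import Mathlib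

open scoped BoundedContinuousFunction ComplexConjugate Complex.UnitDisc

noncomputable section

namespace HoffmanMaps

open Filter Topology Complex WeakDual

/-- A function on the open unit disc is holomorphic if it is the restriction to the disc of a
function `G : ℂ → ℂ` which is complex differentiable on the open unit ball. -/
def IsHolo (g : 𝔻 → ℂ) : Prop :=
  ∃ G : ℂ → ℂ, DifferentiableOn ℂ G (Metric.ball 0 1) ∧ ∀ z : 𝔻, G z = g z

/-- The algebra `H^∞` of bounded holomorphic functions on the unit disc, with the supremum norm
(as a subalgebra of the bounded continuous functions on the disc). -/
def Hinf : Subalgebra ℂ (𝔻 →ᵇ ℂ) where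
  carrier := {f | IsHolo f}
  mul_mem' := by
    rintro f g ⟨F, hF, hFf⟩ ⟨G, hG, hGg⟩
    exact ⟨F * G, hF.mul hG, fun z => by simp [hFf, hGg]⟩
  add_mem' := by
    rintro f g ⟨F, hF, hFf⟩ ⟨G, hG, hGg⟩
    exact ⟨F + G, hF.add hG, fun z => by simp [hFf, hGg]⟩
  algebraMap_mem' := by
    intro c
    exact ⟨fun _ => c, differentiableOn_const c, fun z => by simp⟩

theorem mem_Hinf {f : 𝔻 →ᵇ ℂ} : f ∈ Hinf ↔ IsHolo f := Iff.rfl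

/-- `H^∞` is closed under uniform limits. -/
theorem isClosed_Hinf : IsClosed (Hinf : Set (𝔻 →ᵇ ℂ)) := by
  refine isClosed_of_closure_subset fun f hf => ?_
  obtain ⟨u, hu, hlim⟩ := mem_closure_iff_seq_limit.1 hf
  choose G hG hGu using hu
  have hlim' := BoundedContinuousFunction.tendsto_iff_tendstoUniformly.1 hlim
  have hunif : TendstoUniformlyOn G
      (fun z => if h : ‖z‖ < 1 then f (UnitDisc.mk z h) else 0) atTop (Metric.ball 0 1) := by
    rw [Metric.tendstoUniformlyOn_iff]
    intro ε hε
    filter_upwards [Metric.tendstoUniformly_iff.1 hlim' ε hε] with n hn z hz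
    have hz' : ‖z‖ < 1 := mem_ball_zero_iff.1 hz
    have h1 : G n z = u n (UnitDisc.mk z hz') := hGu n (UnitDisc.mk z hz')
    rw [dif_pos hz', h1]
    exact hn _
  refine ⟨_, hunif.tendstoLocallyUniformlyOn.differentiableOn
    (Eventually.of_forall hG) Metric.isOpen_ball, fun z => ?_⟩
  rw [dif_pos z.norm_lt_one, UnitDisc.mk_coe]

instance : CompleteSpace Hinf := isClosed_Hinf.completeSpace_coe

/-- The maximal ideal space of `H^∞`: the nonzero multiplicative linear functionals on `H^∞`
with the weak-star topology. -/
abbrev MaxIdealSpace : Type := characterSpace ℂ Hinf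

/-- Evaluation at a point of the disc, as an algebra homomorphism. -/
def evalHom (z : 𝔻) : Hinf →ₐ[ℂ] ℂ where
  toFun f := (f : 𝔻 →ᵇ ℂ) z
  map_one' := rfl
  map_mul' _ _ := rfl
  map_zero' := rfl
  map_add' _ _ := rfl
  commutes' _ := rfl

/-- The canonical embedding of the disc into the maximal ideal space. -/
def ofDisc (z : 𝔻) : MaxIdealSpace := CharacterSpace.equivAlgHom.symm (evalHom z)

@[simp] theorem ofDisc_apply (z : 𝔻) (f : Hinf) : ofDisc z f = (f : 𝔻 →ᵇ ℂ) z := rfl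

instance : Nonempty MaxIdealSpace := ⟨ofDisc 0⟩

/-- The trace on the disc of the neighborhood filter of `m`. A limit along this filter is a common
limit along all nets in the disc that tend to `m`. -/
def discNhds (m : MaxIdealSpace) : Filter 𝔻 := comap ofDisc (𝓝 m)

theorem one_add_conj_mul_ne_zero {a b : ℂ} (ha : ‖a‖ ≤ 1) (hb : ‖b‖ < 1) :
    1 + conj a * b ≠ 0 := by
  intro h
  have h1 : conj a * b = -1 := by linear_combination h
  have h2 : ‖a‖ * ‖b‖ = 1 := by simpa using congrArg norm h1
  nlinarith [norm_nonneg a, norm_nonneg b]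

/-- The automorphism `L_w(z) = (z + w) / (1 + conj w * z)` of the disc. -/
def discAut (w z : 𝔻) : 𝔻 :=
  UnitDisc.mk (((z : ℂ) + w) / (1 + conj (w : ℂ) * z)) (by
    have hne := one_add_conj_mul_ne_zero w.norm_lt_one.le z.norm_lt_one
    have hz := z.normSq_lt_one
    have hw := w.normSq_lt_one
    rw [norm_div, div_lt_one (norm_pos_iff.2 hne), ← sq_lt_sq₀ (norm_nonneg _) (norm_nonneg _),
      ← normSq_eq_norm_sq, ← normSq_eq_norm_sq]
    simp only [normSq_apply, add_re, add_im, mul_re, mul_im, conj_re, conj_im, one_re,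
      one_im] at hz hw ⊢
    nlinarith [mul_pos (sub_pos.2 hz) (sub_pos.2 hw)])

/-- The Hoffman map `L_m` on the disc: the pointwise limit, in the maximal ideal space, of the
automorphisms `L_w` as `w` tends to `m` through the disc. -/
def hoffman (m : MaxIdealSpace) (z : 𝔻) : MaxIdealSpace :=
  limUnder (discNhds m) fun w => ofDisc (discAut w z)

/-- A map `τ` from the disc to the maximal ideal space is analytic if `f ∘ τ ∈ H^∞` for all
`f ∈ H^∞`. -/
def IsAnalyticMap (τ : 𝔻 → MaxIdealSpace) : Prop :=
  ∀ f : Hinf, ∃ g : Hinf, ∀ z : 𝔻, (g : 𝔻 →ᵇ ℂ) z = τ z f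

/-- The composition operator `f ↦ f ∘ τ` on `H^∞`. -/
def compHom {τ : 𝔻 → MaxIdealSpace} (hτ : IsAnalyticMap τ) : Hinf →ₐ[ℂ] Hinf where
  toFun f := (hτ f).choose
  map_one' := by
    ext z
    exact ((hτ 1).choose_spec z).trans (map_one (τ z))
  map_mul' f g := by
    ext z
    refine ((hτ (f * g)).choose_spec z).trans ((map_mul (τ z) f g).trans ?_)
    exact congrArg₂ (· * ·) ((hτ f).choose_spec z).symm ((hτ g).choose_spec z).symm
  map_zero' := by
    ext z
    exact ((hτ 0).choose_spec z).trans (map_zero (τ z))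
  map_add' f g := by
    ext z
    refine ((hτ (f + g)).choose_spec z).trans ((map_add (τ z) f g).trans ?_)
    exact congrArg₂ (· + ·) ((hτ f).choose_spec z).symm ((hτ g).choose_spec z).symm
  commutes' c := by
    ext z
    exact ((hτ _).choose_spec z).trans (AlgHomClass.commutes (τ z) c)

theorem compHom_apply {τ : 𝔻 → MaxIdealSpace} (hτ : IsAnalyticMap τ) (f : Hinf) (z : 𝔻) :
    (compHom hτ f : 𝔻 →ᵇ ℂ) z = τ z f := (hτ f).choose_spec z

open Classical in
/-- The extension `τ*` of an analytic map `τ` from the disc to the whole maximal ideal space,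
`τ*(φ)(f) = φ(f ∘ τ)`. (A constant map if `τ` is not analytic.) -/
def extend (τ : 𝔻 → MaxIdealSpace) (φ : MaxIdealSpace) : MaxIdealSpace :=
  if hτ : IsAnalyticMap τ then
    CharacterSpace.equivAlgHom.symm ((CharacterSpace.toAlgHom φ).comp (compHom hτ))
  else τ 0

theorem extend_apply {τ : 𝔻 → MaxIdealSpace} (hτ : IsAnalyticMap τ) (φ : MaxIdealSpace)
    (f : Hinf) : extend τ φ f = φ (compHom hτ f) := by
  rw [extend, dif_pos hτ]; rfl

/-- `τ*` does extend `τ`. -/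
theorem extend_ofDisc {τ : 𝔻 → MaxIdealSpace} (hτ : IsAnalyticMap τ) (z : 𝔻) :
    extend τ (ofDisc z) = τ z := by
  refine CharacterSpace.ext fun f => ?_
  rw [extend_apply hτ, ofDisc_apply, compHom_apply]

/-- The Hoffman map `L_m`, extended to the whole maximal ideal space. -/
def hoffmanExt (m : MaxIdealSpace) : MaxIdealSpace → MaxIdealSpace := extend (hoffman m)

/-- The fiber `L_m⁻¹(L_m(y))` in the maximal ideal space (the `m`-saturation of `y`). -/
def saturation (m y : MaxIdealSpace) : Set MaxIdealSpace :=
  hoffmanExt m ⁻¹' {hoffmanExt m y}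

/-- The identity function `z` of the disc, as an element of `H^∞`. -/
def coordFun : Hinf :=
  ⟨BoundedContinuousFunction.ofNormedAddCommGroup (fun z : 𝔻 => (z : ℂ))
    UnitDisc.continuous_coe 1 (fun z => z.norm_lt_one.le), id, differentiableOn_id, fun _ => rfl⟩

@[simp] theorem coordFun_apply (z : 𝔻) : (coordFun : 𝔻 →ᵇ ℂ) z = z := rfl

/-- The projection `π` of the maximal ideal space onto the closed disc, `π(x) = x(z)`. -/
def proj (x : MaxIdealSpace) : ℂ := x coordFun

theorem norm_proj_le (x : MaxIdealSpace) : ‖proj x‖ ≤ 1 := by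
  refine (AlgHom.norm_apply_le_self_mul_norm_one (𝕜 := ℂ) x coordFun).trans ?_
  have h1 : ‖coordFun‖ ≤ 1 :=
    (BoundedContinuousFunction.norm_le zero_le_one).2 fun z => z.norm_lt_one.le
  have h2 : ‖(1 : Hinf)‖ ≤ 1 :=
    (BoundedContinuousFunction.norm_le zero_le_one).2 fun z => by simp
  nlinarith [norm_nonneg coordFun, norm_nonneg (1 : Hinf)]

/-- The unimodular number `(1 + conj π(x) * w) / (1 + π(x) * conj w)`. -/
def lamApprox (x : MaxIdealSpace) (w : 𝔻) : Circle :=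
  ⟨(1 + conj (proj x) * w) / (1 + proj x * conj (w : ℂ)), by
    have hne := one_add_conj_mul_ne_zero (norm_proj_le x) w.norm_lt_one
    have h : 1 + proj x * conj (w : ℂ) = conj (1 + conj (proj x) * (w : ℂ)) := by simp
    refine mem_sphere_zero_iff_norm.2 ?_
    rw [h, norm_div, RCLike.norm_conj]
    exact div_self (norm_ne_zero_iff.2 hne)⟩

/-- The function `λ(x, y)`: the limit of `(1 + conj π(x) * w) / (1 + π(x) * conj w)` as `w` tends
to `y` through the disc. -/
def lam (x y : MaxIdealSpace) : Circle := limUnder (discNhds y) (lamApprox x)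

/-- The pseudohyperbolic distance on the disc. -/
def pseudoDist (z w : 𝔻) : ℝ := ‖((z : ℂ) - w) / (1 - conj (w : ℂ) * z)‖

/-- `S` is (the set of terms of) an interpolating sequence: the zero set of a Blaschke product,
with simple zeros, such that `δ(S) = inf_{z ∈ S} ∏_{w ∈ S, w ≠ z} ρ(z, w) > 0`. -/
def IsInterpolating (S : Set 𝔻) : Prop :=
  Summable (fun z : S => 1 - ‖(z : ℂ)‖) ∧
    0 < ⨅ z : S, ∏' w : {w : S // w ≠ z}, pseudoDist z w

/-- The set `𝒢` of points in the closure of some interpolating sequence. -/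
def goodPoints : Set MaxIdealSpace :=
  {m | ∃ S : Set 𝔻, IsInterpolating S ∧ m ∈ closure (ofDisc '' S)}

end HoffmanMaps

end

/-!
The disc automorphisms satisfy `L_w(L_u(λ(w, u) z)) = L_{L_w(u)}(z)` (`discAut_discAut_smul`). If
`u → x` and `w → m` this becomes `L_m(L_x(λ(m, x) z)) = L_{L_m(x)}(z)` (`hoffmanExt_hoffman`), as
soon as the Hoffman maps of `m`, `x` and `L_m(x)` exist as limits. For `L_m(x) = m` it says that
`L_x(λ(m, x) ω)` is in the fiber of `L_m(ω)`. Conversely, let `L_m(ξ) = L_m(ω) = y`. The number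
`z = - conj λ(m, ω) ω` has `L_y(z) = m` by the composition law for `(m, ω)`, so that the law for
`(m, ξ)` shows that `x = L_ξ(λ(m, ξ) z)` satisfies `L_m(x) = m`. The law for `ξ` and the point
`λ(m, ξ) z` of the disc gives back `ξ` as a value `L_x(c ω)` with `|c| = 1`, and `c = λ(m, x)` by the
cocycle identity for `λ` (`lamApprox_cocycle`, `lam_hoffman_mul`).

What has to be shown is that all the limits exist, that is, that the points involved are in the
closure of the disc and have Hoffman maps. No corona theorem is needed, since all of them are in `𝒢`:

* For `m ∈ 𝒢` the limits defining `L_m` exist (`tendsto_hoffman`). If `m` is in the closure of the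
  uniformly separated set `S`, then points `w → m` of the disc are asymptotically in `S`, because the
  Blaschke product of `S` tends to `0` at them. On `S` there is only one ultrafilter that converges
  to `m`, because Blaschke products separate disjoint subsets of `S`.
* If `m` and `L_m(ξ)` are in `𝒢`, so is `ξ` (`mem_goodPoints_of_hoffmanExt`). Indeed, if `b` is the
  Blaschke product of a uniformly separated set with `L_m(ξ)` in its closure, then `b ∘ L_m` is the
  Blaschke product of a uniformly separated set `Z` times a unit of `H^∞`, and it vanishes at `ξ`.
  Hence `ξ` is in the closure of `Z` by `UniformlySeparated.mem_closure`.
* If `m ∈ 𝒢` then `L_m(ω) ∈ 𝒢` (`hoffman_mem_goodPoints`).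

These facts rest on Carleson's interpolation theorem for uniformly separated sets
(`UniformlySeparated.exists_interpolation`), proved for finite sets by the explicit formula of
P. Jones. Infinite Blaschke products, infinite interpolation problems and the functions `f ∘ L_m` are
all obtained from the compactness of balls of `H^∞` for pointwise convergence along ultrafilters
(`exists_Hinf_tendsto`). Finally, the limits `λ(m, x)` exist for all `x` since the argument of
`1 + conj π(m) w` is, up to sign, the logarithm of the modulus of a unit of `H^∞`
(`tendsto_lamApprox`).
-/

noncomputable section

namespace HoffmanMaps

open Filter Topology Complex WeakDual

/-! ### The automorphisms of the disc -/

theorem coe_discAut (w z : 𝔻) :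
    (discAut w z : ℂ) = ((z : ℂ) + w) / (1 + conj (w : ℂ) * z) := rfl

theorem coe_lamApprox (x : MaxIdealSpace) (w : 𝔻) :
    (lamApprox x w : ℂ) = (1 + conj (proj x) * w) / (1 + proj x * conj (w : ℂ)) := rfl

@[simp] theorem proj_ofDisc (w : 𝔻) : proj (ofDisc w) = w := rfl

theorem one_add_mul_conj_ne_zero {a b : ℂ} (ha : ‖a‖ ≤ 1) (hb : ‖b‖ < 1) :
    1 + a * conj b ≠ 0 := by
  have := one_add_conj_mul_ne_zero (a := conj a) (b := conj b) (by simpa) (by simpa)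
  simpa using this

@[simp] theorem discAut_zero_right (w : 𝔻) : discAut w 0 = w := by
  apply UnitDisc.coe_injective; simp [coe_discAut]

@[simp] theorem discAut_zero_left (z : 𝔻) : discAut 0 z = z := by
  apply UnitDisc.coe_injective; simp [coe_discAut]

@[simp] theorem discAut_self_neg (w : 𝔻) : discAut w (-w) = 0 := by
  apply UnitDisc.coe_injective; simp [coe_discAut]

@[simp] theorem discAut_neg_self (w : 𝔻) : discAut (-w) w = 0 := by
  apply UnitDisc.coe_injective; simp [coe_discAut]

/-- The composition law of the disc automorphisms: `L_w ∘ L_u` is `L_{L_w(u)}` up to the rotation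
by `λ(w, u)`. -/
theorem discAut_discAut_smul (w u z : 𝔻) :
    discAut w (discAut u (lamApprox (ofDisc w) u • z)) = discAut (discAut w u) z := by
  apply UnitDisc.coe_injective
  have hw := w.norm_lt_one
  have hu := u.norm_lt_one
  have h1 := one_add_conj_mul_ne_zero hw.le hu
  have h2 := one_add_mul_conj_ne_zero hw.le hu
  have h3 := one_add_conj_mul_ne_zero hu.le (lamApprox (ofDisc w) u • z).norm_lt_one
  have h4 := one_add_conj_mul_ne_zero hw.le (discAut u (lamApprox (ofDisc w) u • z)).norm_lt_one
  have h5 := one_add_conj_mul_ne_zero (discAut w u).norm_lt_one.le z.norm_lt_one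
  simp only [coe_discAut, UnitDisc.coe_circle_smul, coe_lamApprox, proj_ofDisc, map_div₀, map_add,
    map_mul, map_one, conj_conj] at h1 h2 h3 h4 h5 ⊢
  generalize conj (w : ℂ) = w' at *
  generalize conj (u : ℂ) = u' at *
  generalize hn : 1 + w' * (u : ℂ) = n at *
  generalize hd : 1 + (w : ℂ) * u' = d at *
  have e1 : n / d * d = n := div_mul_cancel₀ n h2
  have e2 : n * (1 + (u' + w') / d * (z : ℂ)) = n + (u' + w') * (n / d) * z := by ring
  have e3 : n * ((z : ℂ) + (u + w) / n) = n * z + (u + w) := by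
    rw [mul_add, mul_div_cancel₀ _ h1]
  rw [← mul_div_mul_left _ (1 + (u' + w') / d * (z : ℂ)) h1, e2, e3,
    ← mul_div_mul_left _ _ h3]
  congr 1
  · rw [mul_add, mul_div_cancel₀ _ h3]
    linear_combination (z : ℂ) * e1 + n / d * (z : ℂ) * hd
  · rw [mul_add, mul_one, mul_left_comm _ w', mul_div_cancel₀ _ h3]
    linear_combination hn

theorem smul_inv_discAut (c : Circle) (v z : 𝔻) : discAut v (c • z) = c • discAut (c⁻¹ • v) z := by
  apply UnitDisc.coe_injective
  have hc : conj (c : ℂ) = (c : ℂ)⁻¹ := by rw [← Circle.coe_inv_eq_conj, Circle.coe_inv]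
  have hc0 : (c : ℂ) ≠ 0 := Circle.coe_ne_zero c
  simp only [coe_discAut, UnitDisc.coe_circle_smul, map_mul, Circle.coe_inv, map_inv₀, hc, inv_inv]
  field_simp

@[simp] theorem discAut_neg_discAut (w z : 𝔻) : discAut (-w) (discAut w z) = z := by
  have := discAut_discAut_smul (-w) w ((lamApprox (ofDisc (-w)) w)⁻¹ • z)
  rw [smul_inv_smul] at this
  rw [this, discAut_neg_self, discAut_zero_left]
  have h : lamApprox (ofDisc (-w)) w = 1 := by
    apply Circle.coe_injective
    rw [coe_lamApprox, Circle.coe_one, div_eq_one_iff_eq]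
    · simp [mul_comm]
    · exact one_add_mul_conj_ne_zero (norm_proj_le _) w.norm_lt_one
  simp [h]

@[simp] theorem discAut_discAut_neg (w z : 𝔻) : discAut w (discAut (-w) z) = z := by
  simpa using discAut_neg_discAut (-w) z

theorem pseudoDist_eq (z w : 𝔻) : pseudoDist z w = ‖(discAut (-w) z : ℂ)‖ := by
  simp [pseudoDist, coe_discAut, sub_eq_add_neg]

theorem pseudoDist_nonneg (z w : 𝔻) : 0 ≤ pseudoDist z w := norm_nonneg _

theorem pseudoDist_lt_one (z w : 𝔻) : pseudoDist z w < 1 := by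
  rw [pseudoDist_eq]; exact UnitDisc.norm_lt_one _

@[simp] theorem pseudoDist_self (z : 𝔻) : pseudoDist z z = 0 := by simp [pseudoDist]

theorem pseudoDist_comm (z w : 𝔻) : pseudoDist z w = pseudoDist w z := by
  rw [pseudoDist, pseudoDist, norm_div, norm_div, norm_sub_rev]
  congr 1
  rw [← RCLike.norm_conj]
  simp [mul_comm]

/-- Every disc automorphism intertwines a Blaschke factor with a rotated Blaschke factor. -/
theorem exists_discAut_neg_discAut (s w : 𝔻) : ∃ c : Circle, ∃ v : 𝔻,
    ∀ z, discAut (-s) (discAut w z) = c • discAut (-v) z := by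
  refine ⟨(lamApprox (ofDisc (-s)) w)⁻¹, -(lamApprox (ofDisc (-s)) w • discAut (-s) w),
    fun z => ?_⟩
  have := discAut_discAut_smul (-s) w ((lamApprox (ofDisc (-s)) w)⁻¹ • z)
  rw [smul_inv_smul] at this
  rw [this, smul_inv_discAut, inv_inv, neg_neg]

theorem discAut_neg_eq_zero {s z : 𝔻} : discAut (-s) z = 0 ↔ z = s := by
  refine ⟨fun h => ?_, fun h => by simp [h]⟩
  have := congrArg (discAut s) h
  simpa using this

theorem pseudoDist_discAut (w a b : 𝔻) :
    pseudoDist (discAut w a) (discAut w b) = pseudoDist a b := by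
  obtain ⟨c, v, h⟩ := exists_discAut_neg_discAut (discAut w b) w
  have hb := h b
  rw [discAut_neg_self] at hb
  have hv : b = v := by
    rw [← discAut_neg_eq_zero]
    have := congrArg (fun z => c⁻¹ • z) hb
    simp only [inv_smul_smul] at this
    rw [← this]
    apply UnitDisc.coe_injective
    simp
  rw [pseudoDist_eq, h a, pseudoDist_eq, hv, UnitDisc.coe_circle_smul, norm_mul, Circle.norm_coe,
    one_mul]

theorem pseudoDist_pos {z w : 𝔻} (h : z ≠ w) : 0 < pseudoDist z w := by
  rw [pseudoDist_eq, norm_pos_iff, Ne, UnitDisc.coe_eq_zero, discAut_neg_eq_zero]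
  exact h

theorem pseudoDist_discAut_left (z t : 𝔻) : pseudoDist (discAut z t) z = ‖(t : ℂ)‖ := by
  rw [pseudoDist_eq, discAut_neg_discAut]

theorem one_sub_pseudoDist_sq (z w : 𝔻) : 1 - pseudoDist z w ^ 2 =
    (1 - ‖(z : ℂ)‖ ^ 2) * (1 - ‖(w : ℂ)‖ ^ 2) / ‖1 - conj (w : ℂ) * z‖ ^ 2 := by
  have h := one_add_conj_mul_ne_zero (a := -w) (by simpa using w.norm_lt_one.le) z.norm_lt_one
  have h' : 1 - conj (w : ℂ) * z ≠ 0 := by simpa [sub_eq_add_neg] using h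
  have h0 : ‖1 - conj (w : ℂ) * z‖ ^ 2 ≠ 0 := by simpa using h'
  rw [pseudoDist, norm_div, div_pow, eq_div_iff h0, sub_mul, div_mul_cancel₀ _ h0]
  simp only [← normSq_eq_norm_sq, normSq_apply, sub_re, sub_im, mul_re, mul_im, conj_re, conj_im,
    one_re, one_im]
  ring

theorem tendsto_coe_iff {ι : Type*} {l : Filter ι} {u : ι → 𝔻} {a : 𝔻} :
    Tendsto (fun i => (u i : ℂ)) l (𝓝 (a : ℂ)) ↔ Tendsto u l (𝓝 a) :=
  UnitDisc.isEmbedding_coe.tendsto_nhds_iff.symm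

theorem tendsto_discAut {ι : Type*} {l : Filter ι} {u v : ι → 𝔻} {a b : 𝔻}
    (hu : Tendsto u l (𝓝 a)) (hv : Tendsto v l (𝓝 b)) :
    Tendsto (fun i => discAut (u i) (v i)) l (𝓝 (discAut a b)) := by
  rw [← tendsto_coe_iff] at hu hv ⊢
  simp only [coe_discAut]
  refine (hv.add hu).div (((continuous_conj.tendsto _).comp hu).mul hv |>.const_add 1) ?_
  exact one_add_conj_mul_ne_zero a.norm_lt_one.le b.norm_lt_one

theorem tendsto_circle_smul {ι : Type*} {l : Filter ι} {c : ι → Circle} {u : ι → 𝔻} {c₀ : Circle}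
    {a : 𝔻} (hc : Tendsto c l (𝓝 c₀)) (hu : Tendsto u l (𝓝 a)) :
    Tendsto (fun i => c i • u i) l (𝓝 (c₀ • a)) := by
  rw [← tendsto_coe_iff] at hu ⊢
  simp only [UnitDisc.coe_circle_smul]
  exact ((continuous_subtype_val.tendsto _).comp hc).mul hu

theorem tendsto_pseudoDist {ι : Type*} {l : Filter ι} {u v : ι → 𝔻} {a b : 𝔻}
    (hu : Tendsto u l (𝓝 a)) (hv : Tendsto v l (𝓝 b)) :
    Tendsto (fun i => pseudoDist (u i) (v i)) l (𝓝 (pseudoDist a b)) := by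
  simp only [pseudoDist_eq]
  refine (tendsto_coe_iff.2 (tendsto_discAut ?_ hu)).norm
  rw [← tendsto_coe_iff] at hv ⊢
  simpa using hv.neg

/-! ### Bounded holomorphic functions -/

/-- `f` is bounded by `C` on the disc, that is, `‖f‖ ≤ C` in `H^∞`. -/
def BoundedBy (f : Hinf) (C : ℝ) : Prop := ∀ z, ‖f.1 z‖ ≤ C

theorem exists_boundedBy (f : Hinf) : ∃ C, BoundedBy f C := ⟨‖f.1‖, f.1.norm_coe_le_norm⟩

theorem exists_Hinf {G : ℂ → ℂ} (hG : DifferentiableOn ℂ G (Metric.ball 0 1)) {C : ℝ}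
    (hC : ∀ z : 𝔻, ‖G z‖ ≤ C) : ∃ f : Hinf, BoundedBy f C ∧ ∀ z, f.1 z = G z := by
  have hcont : Continuous fun z : 𝔻 => G z :=
    hG.continuousOn.comp_continuous UnitDisc.continuous_coe fun z =>
      mem_ball_zero_iff.2 z.norm_lt_one
  exact ⟨⟨BoundedContinuousFunction.ofNormedAddCommGroup (fun z : 𝔻 => G z) hcont C hC,
    G, hG, fun _ => rfl⟩, hC, fun _ => rfl⟩

theorem Hinf_ext {f g : Hinf} (h : ∀ z, f.1 z = g.1 z) : f = g :=
  Subtype.ext (BoundedContinuousFunction.ext h)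

theorem Hinf_mul_apply (f g : Hinf) (z : 𝔻) : (f * g).1 z = f.1 z * g.1 z := rfl
theorem Hinf_sub_apply (f g : Hinf) (z : 𝔻) : (f - g).1 z = f.1 z - g.1 z := rfl
theorem Hinf_one_apply (z : 𝔻) : (1 : Hinf).1 z = 1 := rfl
theorem Hinf_algebraMap_apply (c : ℂ) (z : 𝔻) : (algebraMap ℂ Hinf c).1 z = c := rfl

theorem Hinf_sum_apply {ι : Type*} (s : Finset ι) (f : ι → Hinf) (z : 𝔻) :
    (∑ i ∈ s, f i).1 z = ∑ i ∈ s, (f i).1 z := map_sum (evalHom z) f s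

theorem Hinf_prod_apply {ι : Type*} (s : Finset ι) (f : ι → Hinf) (z : 𝔻) :
    (∏ i ∈ s, f i).1 z = ∏ i ∈ s, (f i).1 z := map_prod (evalHom z) f s

theorem Hinf_continuous (f : Hinf) : Continuous f.1 := f.1.continuous

/-- `H^∞` is invariant under composition with disc automorphisms. -/
theorem exists_comp_discAut (f : Hinf) (w : 𝔻) : ∃ g : Hinf, ∀ z, g.1 z = f.1 (discAut w z) := by
  obtain ⟨C, hC⟩ := exists_boundedBy f
  obtain ⟨F, hF, hFf⟩ := f.2
  have hmaps : Set.MapsTo (fun z : ℂ => (z + w) / (1 + conj (w : ℂ) * z)) (Metric.ball 0 1)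
      (Metric.ball 0 1) := fun z hz =>
    mem_ball_zero_iff.2 (discAut w (UnitDisc.mk z (mem_ball_zero_iff.1 hz))).norm_lt_one
  obtain ⟨g, -, hgz⟩ := exists_Hinf (C := C) (hF.comp (DifferentiableOn.fun_div
    (differentiableOn_id.add_const _) ((differentiableOn_id.const_mul _).const_add _)
    fun z hz => one_add_conj_mul_ne_zero w.norm_lt_one.le (mem_ball_zero_iff.1 hz)) hmaps)
    (fun z => by
      have : F (discAut w z) = f.1 (discAut w z) := hFf _
      exact (congrArg norm this).trans_le (hC _))
  exact ⟨g, fun z => (hgz z).trans (hFf (discAut w z))⟩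

/-- The composition `f ∘ L_w`. -/
def compAut (w : 𝔻) (f : Hinf) : Hinf := (exists_comp_discAut f w).choose

theorem compAut_apply (w : 𝔻) (f : Hinf) (z : 𝔻) :
    (compAut w f).1 z = f.1 (discAut w z) := (exists_comp_discAut f w).choose_spec z

theorem BoundedBy.compAut {f : Hinf} {C : ℝ} (h : BoundedBy f C) (w : 𝔻) :
    BoundedBy (compAut w f) C := fun z => by
  rw [compAut_apply]; exact h _

/-- The Blaschke factor `(z - a) / (1 - conj a * z)`, that is, the automorphism `L_{-a}`. -/
def blaschkeFactor (a : 𝔻) : Hinf := compAut (-a) coordFun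

theorem blaschkeFactor_apply (a z : 𝔻) : (blaschkeFactor a).1 z = discAut (-a) z := by
  rw [blaschkeFactor, compAut_apply, coordFun_apply]

theorem blaschkeFactor_self (a : 𝔻) : (blaschkeFactor a).1 a = 0 := by
  rw [blaschkeFactor_apply, discAut_neg_self, UnitDisc.coe_zero]

theorem norm_blaschkeFactor_apply (a z : 𝔻) : ‖(blaschkeFactor a).1 z‖ = pseudoDist z a := by
  rw [blaschkeFactor_apply, pseudoDist_eq]

theorem boundedBy_blaschkeFactor (a : 𝔻) : BoundedBy (blaschkeFactor a) 1 := fun z =>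
  (norm_blaschkeFactor_apply a z).trans_le (pseudoDist_lt_one z a).le

theorem blaschkeFactor_ne_zero {a z : 𝔻} (h : z ≠ a) : (blaschkeFactor a).1 z ≠ 0 := by
  rw [← norm_pos_iff, norm_blaschkeFactor_apply]
  exact pseudoDist_pos h

/-- Schwarz lemma: a zero at the origin can be divided out without increasing the norm. -/
theorem exists_eq_coord_mul {f : Hinf} {C : ℝ} (hC : BoundedBy f C) (h0 : f.1 0 = 0) :
    ∃ g : Hinf, BoundedBy g C ∧ ∀ z : 𝔻, f.1 z = z * g.1 z := by
  obtain ⟨F, hF, hFf⟩ := f.2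
  have hF0 : F 0 = 0 := (hFf 0).trans h0
  have hd : DifferentiableOn ℂ (dslope F 0) (Metric.ball 0 1) :=
    (differentiableOn_dslope (Metric.ball_mem_nhds 0 one_pos)).2 hF
  have hm : Set.MapsTo F (Metric.ball 0 1) (Metric.closedBall (F 0) C) := fun z hz => by
    rw [hF0, mem_closedBall_zero_iff]
    have := hFf (UnitDisc.mk z (mem_ball_zero_iff.1 hz))
    rw [UnitDisc.coe_mk] at this
    rw [this]
    exact hC _
  obtain ⟨g, hg, hgz⟩ := exists_Hinf hd (C := C) fun z => by
    simpa using norm_dslope_le_div_of_mapsTo_ball hF hm (mem_ball_zero_iff.2 z.norm_lt_one)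
  refine ⟨g, hg, fun z => ?_⟩
  have := sub_smul_dslope F 0 z
  rw [hF0, sub_zero, sub_zero, smul_eq_mul] at this
  rw [hgz, ← hFf, this]

/-- A zero of a bounded holomorphic function can be divided out without increasing the norm. -/
theorem exists_eq_blaschkeFactor_mul {f : Hinf} {C : ℝ} (hC : BoundedBy f C) {a : 𝔻}
    (h : f.1 a = 0) : ∃ g : Hinf, BoundedBy g C ∧ f = blaschkeFactor a * g := by
  obtain ⟨g, hg, hgz⟩ := exists_eq_coord_mul (hC.compAut a)
    (by rw [compAut_apply, discAut_zero_right, h])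
  refine ⟨compAut (-a) g, hg.compAut _, Hinf_ext fun z => ?_⟩
  have := hgz (discAut (-a) z)
  rwa [compAut_apply, discAut_discAut_neg, ← blaschkeFactor_apply, ← compAut_apply (-a) g] at this

theorem norm_apply_discAut_sub_le {f : Hinf} {C : ℝ} (hC : BoundedBy f C) (z t : 𝔻) :
    ‖f.1 (discAut z t) - f.1 z‖ ≤ 2 * C * ‖(t : ℂ)‖ := by
  have hn : BoundedBy (compAut z f - algebraMap ℂ Hinf (f.1 z)) (2 * C) := fun u => by
    rw [Hinf_sub_apply, compAut_apply, Hinf_algebraMap_apply]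
    linarith [norm_sub_le (f.1 (discAut z u)) (f.1 z), hC (discAut z u), hC z]
  obtain ⟨g, hg, hgz⟩ := exists_eq_coord_mul hn
    (by rw [Hinf_sub_apply, compAut_apply, Hinf_algebraMap_apply, discAut_zero_right, sub_self])
  have h := hgz t
  rw [Hinf_sub_apply, compAut_apply, Hinf_algebraMap_apply] at h
  rw [h, norm_mul, mul_comm]
  exact mul_le_mul_of_nonneg_right (hg t) (norm_nonneg _)

/-- Bounded holomorphic functions are Lipschitz for the pseudohyperbolic distance. -/
theorem norm_apply_sub_apply_le {f : Hinf} {C : ℝ} (hC : BoundedBy f C) (z w : 𝔻) :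
    ‖f.1 z - f.1 w‖ ≤ 2 * C * pseudoDist z w := by
  have := norm_apply_discAut_sub_le hC w (discAut (-w) z)
  rwa [discAut_discAut_neg, ← pseudoDist_eq] at this

/-- Bounded families in `H^∞` are equicontinuous. -/
theorem tendsto_apply_sub_apply {ι : Type*} {l : Filter ι} {F : ι → Hinf} {C : ℝ}
    (hF : ∀ i, BoundedBy (F i) C) {u v : ι → 𝔻}
    (h : Tendsto (fun i => pseudoDist (u i) (v i)) l (𝓝 0)) :
    Tendsto (fun i => (F i).1 (u i) - (F i).1 (v i)) l (𝓝 0) := by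
  have h2 := h.const_mul (2 * C)
  rw [mul_zero] at h2
  exact squeeze_zero_norm (fun i => norm_apply_sub_apply_le (hF i) (u i) (v i)) h2

theorem tendsto_apply_of_tendsto {ι : Type*} {l : Filter ι} {F : ι → Hinf} {C : ℝ}
    (hF : ∀ i, BoundedBy (F i) C) {u : ι → 𝔻} {a : 𝔻} (hu : Tendsto u l (𝓝 a)) {c : ℂ}
    (hc : Tendsto (fun i => (F i).1 a) l (𝓝 c)) :
    Tendsto (fun i => (F i).1 (u i)) l (𝓝 c) := by
  have h0 := tendsto_pseudoDist hu (tendsto_const_nhds (x := a))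
  rw [pseudoDist_self] at h0
  have h := (tendsto_apply_sub_apply hF h0).add hc
  rw [zero_add] at h
  exact h.congr fun i => sub_add_cancel _ _

/-- Pointwise limits of bounded families in `H^∞` belong to `H^∞`. -/
theorem exists_Hinf_of_tendsto {ι : Type*} {l : Filter ι} [l.NeBot] {F : ι → Hinf} {C : ℝ}
    (hF : ∀ i, BoundedBy (F i) C) {g : 𝔻 → ℂ}
    (hg : ∀ z, Tendsto (fun i => (F i).1 z) l (𝓝 (g z))) :
    ∃ f : Hinf, BoundedBy f C ∧ ∀ z, f.1 z = g z := by
  choose G hG hGF using fun i => (F i).2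
  have hgC : ∀ z, ‖g z‖ ≤ C := fun z =>
    le_of_tendsto (hg z).norm (Eventually.of_forall fun i => hF i z)
  classical
  let g' : ℂ → ℂ := fun z => if h : ‖z‖ < 1 then g (UnitDisc.mk z h) else 0
  have hg' : ∀ z : 𝔻, g' z = g z := fun z => by simp [g', z.norm_lt_one]
  have hloc : TendstoLocallyUniformlyOn G g' l (Metric.ball 0 1) := by
    rw [Metric.tendstoLocallyUniformlyOn_iff]
    intro ε hε x hx
    lift x to 𝔻 using mem_ball_zero_iff.1 hx
    have hlip : ∀ y : 𝔻, ‖g y - g x‖ ≤ 2 * C * pseudoDist y x := fun y =>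
      le_of_tendsto ((hg y).sub (hg x)).norm (Eventually.of_forall fun i =>
        norm_apply_sub_apply_le (hF i) y x)
    have hcont : Tendsto (fun y : 𝔻 => 2 * C * pseudoDist y x) (𝓝 x) (𝓝 0) := by
      have := (tendsto_pseudoDist (tendsto_id (x := 𝓝 x))
        (tendsto_const_nhds (x := x))).const_mul (2 * C)
      rwa [pseudoDist_self, mul_zero] at this
    have hs := hcont.eventually_lt_const (show (0 : ℝ) < ε / 3 by positivity)
    rw [UnitDisc.isEmbedding_coe.nhds_eq_comap] at hs
    obtain ⟨t, ht, hts⟩ := hs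
    refine ⟨t ∩ Metric.ball 0 1, Filter.inter_mem (mem_nhdsWithin_of_mem_nhds ht)
      self_mem_nhdsWithin, ?_⟩
    filter_upwards [Metric.tendsto_nhds.1 (hg x) (ε / 3) (by positivity)] with i hi y hy
    obtain ⟨hy, hy1⟩ := hy
    lift y to 𝔻 using mem_ball_zero_iff.1 hy1
    have hy' : 2 * C * pseudoDist y x < ε / 3 := hts hy
    have h1 := hlip y
    have h2 := norm_apply_sub_apply_le (hF i) y x
    rw [hg', hGF]
    rw [dist_eq_norm] at hi ⊢
    have h4 : g y - (F i).1 y = (g y - g x) - ((F i).1 y - (F i).1 x) - ((F i).1 x - g x) := by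
      ring
    rw [h4]
    linarith [norm_sub_le ((g y - g x) - ((F i).1 y - (F i).1 x)) ((F i).1 x - g x),
      norm_sub_le (g y - g x) ((F i).1 y - (F i).1 x)]
  obtain ⟨f, hf, hfz⟩ := exists_Hinf (hloc.differentiableOn (Eventually.of_forall hG)
    Metric.isOpen_ball) (C := C) fun z => by rw [hg']; exact hgC z
  exact ⟨f, hf, fun z => (hfz z).trans (hg' z)⟩

theorem exists_tendsto_of_norm_le {ι : Type*} (U : Ultrafilter ι) {u : ι → ℂ} {C : ℝ}
    (h : ∀ᶠ i in U, ‖u i‖ ≤ C) : ∃ c, ‖c‖ ≤ C ∧ Tendsto u U (𝓝 c) := by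
  obtain ⟨c, hc, hc'⟩ := (isCompact_closedBall (0 : ℂ) C).ultrafilter_le_nhds (U.map u) (by
    rw [le_principal_iff]
    exact h.mono (fun i hi => mem_closedBall_zero_iff.2 hi))
  exact ⟨c, mem_closedBall_zero_iff.1 hc, hc'⟩

/-- Montel's theorem: closed balls of `H^∞` are compact for pointwise convergence. -/
theorem exists_Hinf_tendsto {ι : Type*} (U : Ultrafilter ι) {F : ι → Hinf} {C : ℝ}
    (hF : ∀ i, BoundedBy (F i) C) :
    ∃ f : Hinf, BoundedBy f C ∧ ∀ z, Tendsto (fun i => (F i).1 z) U (𝓝 (f.1 z)) := by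
  choose g _ hg using fun z =>
    exists_tendsto_of_norm_le U (Eventually.of_forall fun i => hF i z)
  obtain ⟨f, hf, hfz⟩ := exists_Hinf_of_tendsto hF hg
  exact ⟨f, hf, fun z => by rw [hfz]; exact hg z⟩

/-- The unit disc has no isolated points. -/
theorem exists_seq_tendsto (s : 𝔻) :
    ∃ u : ℕ → 𝔻, (∀ n, u n ≠ s) ∧ Tendsto u atTop (𝓝 s) := by
  have hlt : ∀ n : ℕ, ‖((1 / ((n : ℝ) + 2) : ℝ) : ℂ)‖ < 1 := fun n => by
    rw [norm_real, Real.norm_of_nonneg (by positivity), div_lt_one (by positivity)]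
    linarith [(Nat.cast_nonneg n : (0 : ℝ) ≤ n)]
  refine ⟨fun n => discAut s (UnitDisc.mk _ (hlt n)), fun n h => ?_, ?_⟩
  · have h1 := congrArg (discAut (-s)) h
    rw [discAut_neg_discAut, discAut_neg_self, UnitDisc.mk_eq_zero, ofReal_eq_zero] at h1
    have : (0 : ℝ) < 1 / ((n : ℝ) + 2) := by positivity
    exact this.ne' h1
  · have h0 : Tendsto (fun n => UnitDisc.mk _ (hlt n)) atTop (𝓝 (0 : 𝔻)) := by
      rw [← tendsto_coe_iff]
      simp only [UnitDisc.coe_mk, UnitDisc.coe_zero]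
      rw [← ofReal_zero]
      refine (continuous_ofReal.tendsto _).comp ?_
      exact Tendsto.div_atTop tendsto_const_nhds
        (tendsto_atTop_add_const_right _ _ tendsto_natCast_atTop_atTop)
    simpa using tendsto_discAut (tendsto_const_nhds (x := s)) h0

theorem Hinf_norm_le_of_forall_ne {f g : Hinf} {s : 𝔻} (h : ∀ z, z ≠ s → ‖f.1 z‖ ≤ ‖g.1 z‖) :
    ‖f.1 s‖ ≤ ‖g.1 s‖ := by
  obtain ⟨u, hus, hu⟩ := exists_seq_tendsto s
  exact le_of_tendsto_of_tendsto' (((Hinf_continuous f).norm.tendsto s).comp hu)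
    (((Hinf_continuous g).norm.tendsto s).comp hu) fun n => h _ (hus n)

theorem blaschkeFactor_mul_cancel {a : 𝔻} {f g : Hinf}
    (h : blaschkeFactor a * f = blaschkeFactor a * g) : f = g := by
  have hne : ∀ z, z ≠ a → f.1 z = g.1 z := fun z hz =>
    mul_left_cancel₀ (blaschkeFactor_ne_zero hz) (congrArg (fun F : Hinf => F.1 z) h)
  refine Hinf_ext fun z => ?_
  by_cases hz : z = a
  · subst hz
    have := Hinf_norm_le_of_forall_ne (f := f - g) (g := g - g) (s := z) fun w hw => by
      rw [Hinf_sub_apply, Hinf_sub_apply, hne w hw]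
    rwa [Hinf_sub_apply, Hinf_sub_apply, sub_self, norm_zero, norm_le_zero_iff, sub_eq_zero] at this
  · exact hne z hz

/-! ### Blaschke products -/

/-- The finite Blaschke product with simple zeros at the points of `F`. -/
def finiteBlaschke (F : Finset 𝔻) : Hinf := ∏ a ∈ F, blaschkeFactor a

theorem norm_finiteBlaschke_apply (F : Finset 𝔻) (z : 𝔻) :
    ‖(finiteBlaschke F).1 z‖ = ∏ a ∈ F, pseudoDist z a := by
  rw [finiteBlaschke, Hinf_prod_apply, norm_prod]
  exact Finset.prod_congr rfl fun a _ => norm_blaschkeFactor_apply a z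

theorem prod_pseudoDist_nonneg (F : Finset 𝔻) (z : 𝔻) : 0 ≤ ∏ a ∈ F, pseudoDist z a :=
  Finset.prod_nonneg fun a _ => pseudoDist_nonneg z a

theorem prod_pseudoDist_anti {F G : Finset 𝔻} (h : F ⊆ G) (z : 𝔻) :
    ∏ a ∈ G, pseudoDist z a ≤ ∏ a ∈ F, pseudoDist z a := by
  classical
  rw [← Finset.prod_sdiff h]
  exact mul_le_of_le_one_left (prod_pseudoDist_nonneg F z) (Finset.prod_le_one
    (fun a _ => pseudoDist_nonneg z a) fun a _ => (pseudoDist_lt_one z a).le)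

theorem boundedBy_finiteBlaschke (F : Finset 𝔻) : BoundedBy (finiteBlaschke F) 1 := fun z => by
  rw [norm_finiteBlaschke_apply]
  exact Finset.prod_le_one (fun a _ => pseudoDist_nonneg z a) fun a _ => (pseudoDist_lt_one z a).le

theorem exists_eq_finiteBlaschke_mul (F : Finset 𝔻) : ∀ {f : Hinf} {C : ℝ}, BoundedBy f C →
    (∀ a ∈ F, f.1 a = 0) → ∃ g : Hinf, BoundedBy g C ∧ f = finiteBlaschke F * g := by
  classical
  induction F using Finset.induction_on with
  | empty => exact fun {f C} hC _ => ⟨f, hC, by rw [finiteBlaschke, Finset.prod_empty, one_mul]⟩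
  | insert a F ha ih =>
    intro f C hC hf
    obtain ⟨g, hg, hfg⟩ := exists_eq_blaschkeFactor_mul hC (hf a (Finset.mem_insert_self a F))
    obtain ⟨h, hh, hgh⟩ := ih hg fun b hb => by
      have hb0 := hf b (Finset.mem_insert_of_mem hb)
      rw [hfg, Hinf_mul_apply] at hb0
      exact (mul_eq_zero.1 hb0).resolve_left
        (blaschkeFactor_ne_zero fun hba => ha (hba ▸ hb))
    refine ⟨h, hh, ?_⟩
    rw [finiteBlaschke, Finset.prod_insert ha, mul_assoc, ← finiteBlaschke, ← hgh, hfg]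

/-- An ultrafilter along which finite subsets of `S` exhaust `S`. -/
def exhaustion (S : Set 𝔻) : Ultrafilter (Finset S) := Ultrafilter.of atTop

/-- The underlying finite subset of the disc of a finite subset of `S`. -/
def toDisc {S : Set 𝔻} (F : Finset S) : Finset 𝔻 := F.map (Function.Embedding.subtype _)

theorem toDisc_subset {S : Set 𝔻} (F : Finset S) : (toDisc F : Set 𝔻) ⊆ S := fun z hz => by
  obtain ⟨w, -, rfl⟩ := Finset.mem_map.1 (Finset.mem_coe.1 hz)
  exact w.2

theorem eventually_subset_toDisc {S : Set 𝔻} (F : Finset 𝔻) (hF : (F : Set 𝔻) ⊆ S) :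
    ∀ᶠ G : Finset S in (exhaustion S : Filter (Finset S)), F ⊆ toDisc G := by
  classical
  refine (Ultrafilter.of_le (atTop : Filter (Finset S)))
    ((eventually_ge_atTop (F.subtype (· ∈ S))).mono fun G hG => ?_)
  intro z hz
  exact Finset.mem_map.2 ⟨⟨z, hF hz⟩, hG (Finset.mem_subtype.2 hz), rfl⟩

theorem exists_blaschke (S : Set 𝔻) : ∃ f : Hinf, BoundedBy f 1 ∧
    ∀ z, Tendsto (fun F : Finset S => (finiteBlaschke (toDisc F)).1 z) (exhaustion S)
      (𝓝 (f.1 z)) :=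
  exists_Hinf_tendsto _ fun _ => boundedBy_finiteBlaschke _

/-- A Blaschke product for `S`, as a limit of the finite ones. Its modulus at `z` is the infimum of
the moduli of the finite products, so that it vanishes identically if `S` does not satisfy the
Blaschke condition. -/
def blaschke (S : Set 𝔻) : Hinf := (exists_blaschke S).choose

theorem boundedBy_blaschke (S : Set 𝔻) : BoundedBy (blaschke S) 1 :=
  (exists_blaschke S).choose_spec.1

theorem tendsto_blaschke (S : Set 𝔻) (z : 𝔻) :
    Tendsto (fun F : Finset S => (finiteBlaschke (toDisc F)).1 z) (exhaustion S)
      (𝓝 ((blaschke S).1 z)) :=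
  (exists_blaschke S).choose_spec.2 z

theorem norm_blaschke_le {S : Set 𝔻} {F : Finset 𝔻} (hF : (F : Set 𝔻) ⊆ S) (z : 𝔻) :
    ‖(blaschke S).1 z‖ ≤ ∏ a ∈ F, pseudoDist z a :=
  le_of_tendsto (tendsto_blaschke S z).norm ((eventually_subset_toDisc F hF).mono fun G hG => by
    rw [norm_finiteBlaschke_apply]
    exact prod_pseudoDist_anti hG z)

theorem norm_blaschke_le_pseudoDist {S : Set 𝔻} {a : 𝔻} (ha : a ∈ S) (z : 𝔻) :
    ‖(blaschke S).1 z‖ ≤ pseudoDist z a := by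
  have := norm_blaschke_le (S := S) (F := {a}) (by
    rw [Finset.coe_singleton]; exact Set.singleton_subset_iff.2 ha) z
  rwa [Finset.prod_singleton] at this

theorem blaschke_apply_eq_zero {S : Set 𝔻} {a : 𝔻} (ha : a ∈ S) : (blaschke S).1 a = 0 := by
  have := norm_blaschke_le_pseudoDist ha a
  rwa [pseudoDist_self, norm_le_zero_iff] at this

theorem le_norm_blaschke {S : Set 𝔻} {z : 𝔻} {c : ℝ}
    (h : ∀ F : Finset 𝔻, (F : Set 𝔻) ⊆ S → c ≤ ∏ a ∈ F, pseudoDist z a) :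
    c ≤ ‖(blaschke S).1 z‖ :=
  ge_of_tendsto (tendsto_blaschke S z).norm (Eventually.of_forall fun G => by
    rw [norm_finiteBlaschke_apply]
    exact h _ (toDisc_subset G))

/-- A bounded holomorphic function vanishing on `S` is divisible by the Blaschke product of `S`, and
the quotient obeys the same bound. -/
theorem exists_eq_blaschke_mul {S : Set 𝔻} {f : Hinf} {C : ℝ} (hC : BoundedBy f C)
    (hf : ∀ a ∈ S, f.1 a = 0) : ∃ g : Hinf, BoundedBy g C ∧ f = blaschke S * g := by
  choose G hG hfG using fun F : Finset S =>
    exists_eq_finiteBlaschke_mul (toDisc F) hC fun a ha => hf a (toDisc_subset F ha)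
  obtain ⟨g, hg, hgG⟩ := exists_Hinf_tendsto (exhaustion S) hG
  refine ⟨g, hg, Hinf_ext fun z => ?_⟩
  refine tendsto_nhds_unique (f := fun _ : Finset S => f.1 z) (l := exhaustion S)
    tendsto_const_nhds (((tendsto_blaschke S z).mul (hgG z)).congr fun F => ?_)
  rw [← Hinf_mul_apply, ← hfG]

/-! ### Uniformly separated sets -/

/-- The set `S` is uniformly separated with constant `δ`: Carleson's condition, expressed by the
finite subproducts. -/
def UniformlySeparated (S : Set 𝔻) (δ : ℝ) : Prop :=
  0 < δ ∧ ∀ z ∈ S, ∀ F : Finset 𝔻, (F : Set 𝔻) ⊆ S \ {z} → δ ≤ ∏ w ∈ F, pseudoDist z w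

theorem UniformlySeparated.mono {S T : Set 𝔻} {δ : ℝ} (h : UniformlySeparated S δ) (hT : T ⊆ S) :
    UniformlySeparated T δ :=
  ⟨h.1, fun z hz F hF => h.2 z (hT hz) F (hF.trans (Set.sdiff_subset_sdiff_left hT))⟩

theorem sum_one_sub_sq_le {ι : Type*} {F : Finset ι} {x : ι → ℝ} (h0 : ∀ i ∈ F, 0 ≤ x i) {δ : ℝ}
    (hδ : 0 < δ) (h : δ ≤ ∏ i ∈ F, x i) : ∑ i ∈ F, (1 - x i ^ 2) ≤ -2 * Real.log δ := by
  have hne : ∀ i ∈ F, x i ≠ 0 := Finset.prod_ne_zero_iff.1 (hδ.trans_le h).ne'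
  have h1 : Real.log δ ≤ ∑ i ∈ F, Real.log (x i) := by
    rw [← Real.log_prod hne]; exact Real.log_le_log hδ h
  have h2 : ∑ i ∈ F, (1 - x i ^ 2) ≤ ∑ i ∈ F, -2 * Real.log (x i) :=
    Finset.sum_le_sum fun i hi => by
      have hpos := (h0 i hi).lt_of_ne' (hne i hi)
      have := Real.log_le_sub_one_of_pos (pow_pos hpos 2)
      rw [Real.log_pow] at this
      push_cast at this
      linarith
  rw [← Finset.mul_sum] at h2
  linarith

theorem hasProd_iInf {ι : Type*} {x : ι → ℝ} (h0 : ∀ i, 0 ≤ x i) (h1 : ∀ i, x i ≤ 1) :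
    HasProd x (⨅ F : Finset ι, ∏ i ∈ F, x i) := by
  classical
  have hanti : Antitone fun F : Finset ι => ∏ i ∈ F, x i := fun F G h => by
    dsimp only
    rw [← Finset.prod_sdiff h]
    exact mul_le_of_le_one_left (Finset.prod_nonneg fun i _ => h0 i)
      (Finset.prod_le_one (fun i _ => h0 i) fun i _ => h1 i)
  have := tendsto_atTop_ciInf hanti
    ⟨0, by rintro _ ⟨F, rfl⟩; exact Finset.prod_nonneg fun i _ => h0 i⟩
  simpa [HasProd] using this

theorem hasProd_pseudoDist {S : Set 𝔻} (z : S) :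
    HasProd (fun w : {w : S // w ≠ z} => pseudoDist z w)
      (⨅ F : Finset {w : S // w ≠ z}, ∏ w ∈ F, pseudoDist z w) :=
  hasProd_iInf (fun _ => pseudoDist_nonneg _ _) fun _ => (pseudoDist_lt_one _ _).le

theorem UniformlySeparated.summable {S : Set 𝔻} {δ : ℝ} (h : UniformlySeparated S δ) :
    Summable fun z : S => 1 - ‖(z : ℂ)‖ := by
  classical
  rcases S.eq_empty_or_nonempty with rfl | ⟨z₀, hz₀⟩
  · exact summable_empty
  have hz1 : 0 < 1 - ‖(z₀ : ℂ)‖ ^ 2 := sub_pos.2 z₀.sq_norm_lt_one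
  refine summable_of_sum_le (c := 1 + 4 / (1 - ‖(z₀ : ℂ)‖ ^ 2) * (-2 * Real.log δ))
    (fun z => sub_nonneg.2 z.1.norm_lt_one.le) fun F => ?_
  have hsum := sum_one_sub_sq_le (fun w _ => pseudoDist_nonneg z₀ w) h.1
    (h.2 z₀ hz₀ ((toDisc F).erase z₀) fun z hz => by
      rw [Finset.mem_coe, Finset.mem_erase] at hz
      exact ⟨toDisc_subset F hz.2, hz.1⟩)
  have hterm : ∀ w : 𝔻, 1 - ‖(w : ℂ)‖ ≤
      4 / (1 - ‖(z₀ : ℂ)‖ ^ 2) * (1 - pseudoDist z₀ w ^ 2) := fun w => by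
    have hw := w.norm_lt_one
    have hz := z₀.norm_lt_one
    have hne : 1 - conj (w : ℂ) * z₀ ≠ 0 := by
      simpa [sub_eq_add_neg] using
        one_add_conj_mul_ne_zero (a := -w) (by simpa using hw.le) hz
    have hle : ‖1 - conj (w : ℂ) * z₀‖ ≤ 2 := by
      refine (norm_sub_le _ _).trans ?_
      rw [norm_one, norm_mul, RCLike.norm_conj]
      nlinarith [norm_nonneg (w : ℂ), norm_nonneg (z₀ : ℂ)]
    have hpos := norm_pos_iff.2 hne
    rw [one_sub_pseudoDist_sq, ← mul_div_assoc, ← mul_assoc, div_mul_cancel₀ _ hz1.ne',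
      le_div_iff₀ (by positivity)]
    have : ‖1 - conj (w : ℂ) * z₀‖ ^ 2 ≤ 4 := by nlinarith
    nlinarith [norm_nonneg (w : ℂ)]
  have hF : ∑ z ∈ F, (1 - ‖((z : 𝔻) : ℂ)‖) = ∑ z ∈ toDisc F, (1 - ‖(z : ℂ)‖) := by
    rw [toDisc, Finset.sum_map]; rfl
  rw [hF]
  calc ∑ z ∈ toDisc F, (1 - ‖(z : ℂ)‖)
      ≤ 1 + ∑ z ∈ (toDisc F).erase z₀, (1 - ‖(z : ℂ)‖) := by
        by_cases hz : z₀ ∈ toDisc F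
        · rw [← Finset.add_sum_erase _ _ hz]
          linarith [norm_nonneg (z₀ : ℂ)]
        · rw [Finset.erase_eq_of_notMem hz]
          linarith
    _ ≤ 1 + ∑ z ∈ (toDisc F).erase z₀,
          4 / (1 - ‖(z₀ : ℂ)‖ ^ 2) * (1 - pseudoDist z₀ z ^ 2) := by
        gcongr with z
        exact hterm z
    _ ≤ _ := by
        rw [← Finset.mul_sum]
        gcongr

/-- A nonempty set is an interpolating sequence if and only if it is uniformly separated. -/
theorem isInterpolating_iff {S : Set 𝔻} :
    IsInterpolating S ↔ S.Nonempty ∧ ∃ δ, UniformlySeparated S δ := by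
  classical
  have hbdd : ∀ z : S, BddBelow (Set.range fun F : Finset {w : S // w ≠ z} =>
      ∏ w ∈ F, pseudoDist z w) := fun z => ⟨0, by
    rintro _ ⟨F, rfl⟩; exact Finset.prod_nonneg fun w _ => pseudoDist_nonneg _ _⟩
  constructor
  · rintro ⟨-, hpos⟩
    refine ⟨Set.nonempty_iff_ne_empty.2 ?_, _, hpos, fun z hz F hF => ?_⟩
    · rintro rfl
      rw [Real.iInf_of_isEmpty] at hpos
      exact hpos.false
    · have h1 : (⨅ z : S, ∏' w : {w : S // w ≠ z}, pseudoDist z w) ≤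
          ∏' w : {w : S // w ≠ ⟨z, hz⟩}, pseudoDist z w :=
        ciInf_le (f := fun z : S => ∏' w : {w : S // w ≠ z}, pseudoDist z w) ⟨0, by
          rintro _ ⟨u, rfl⟩
          dsimp only
          rw [(hasProd_pseudoDist u).tprod_eq]
          exact Real.iInf_nonneg fun F => Finset.prod_nonneg fun w _ => pseudoDist_nonneg _ _⟩
          ⟨z, hz⟩
      refine h1.trans ?_
      rw [(hasProd_pseudoDist (⟨z, hz⟩ : S)).tprod_eq]
      let G : Finset {w : S // w ≠ ⟨z, hz⟩} := (F.attach).image fun w =>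
        ⟨⟨w.1, (hF w.2).1⟩, fun h => (hF w.2).2 (congrArg Subtype.val h)⟩
      refine (ciInf_le (hbdd ⟨z, hz⟩) G).trans_eq ?_
      rw [Finset.prod_image fun a _ b _ h =>
        Subtype.ext (congrArg (fun w : {w : S // w ≠ ⟨z, hz⟩} => (w : 𝔻)) h)]
      exact Finset.prod_attach F fun w => pseudoDist z w
  · rintro ⟨⟨z₀, hz₀⟩, δ, h⟩
    refine ⟨h.summable, h.1.trans_le ?_⟩
    have : Nonempty S := ⟨⟨z₀, hz₀⟩⟩
    refine le_ciInf fun z => ?_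
    rw [(hasProd_pseudoDist z).tprod_eq]
    refine le_ciInf fun F => ?_
    refine (h.2 z z.2 (F.image fun w : {w : S // w ≠ z} => ((w : S) : 𝔻)) fun w hw => ?_).trans_eq ?_
    · obtain ⟨u, -, rfl⟩ := Finset.mem_image.1 (Finset.mem_coe.1 hw)
      exact ⟨u.1.2, fun h => u.2 (Subtype.ext h)⟩
    · rw [Finset.prod_image fun a _ b _ h => Subtype.ext (Subtype.ext h)]

/-! ### Carleson's interpolation theorem -/

/-- A discrete form of `∫ exp (-t) dt ≤ 1`, for terms ordered by a height function `r`. -/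
theorem sum_mul_exp_neg_le {ι : Type*} (Z : Finset ι) (r t : ι → ℝ) (ht : ∀ i, 0 ≤ t i) :
    ∑ j ∈ Z, t j * Real.exp (-∑ k ∈ Z with r j ≤ r k, t k) ≤ 1 - Real.exp (-∑ k ∈ Z, t k) := by
  classical
  induction Z using Finset.induction_on_min_value r with
  | empty => simp
  | insert a s ha hmin ih =>
    have h1 : (insert a s).filter (fun k => r a ≤ r k) = insert a s :=
      Finset.filter_true_of_mem fun k hk => by
        rcases Finset.mem_insert.1 hk with rfl | hk
        · exact le_rfl
        · exact hmin k hk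
    rw [Finset.sum_insert ha, h1, Finset.sum_insert ha]
    have h2 : ∑ j ∈ s, t j * Real.exp (-∑ k ∈ insert a s with r j ≤ r k, t k) ≤
        ∑ j ∈ s, t j * Real.exp (-∑ k ∈ s with r j ≤ r k, t k) :=
      Finset.sum_le_sum fun j _ => by
        refine mul_le_mul_of_nonneg_left (Real.exp_le_exp.2 (neg_le_neg ?_)) (ht j)
        exact Finset.sum_le_sum_of_subset_of_nonneg
          (Finset.filter_subset_filter _ (Finset.subset_insert a s)) fun i _ _ => ht i
    have h3 : t a * Real.exp (-(t a + ∑ k ∈ s, t k)) + Real.exp (-(t a + ∑ k ∈ s, t k)) ≤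
        Real.exp (-∑ k ∈ s, t k) := by
      have h4 : Real.exp (-∑ k ∈ s, t k) =
          Real.exp (t a) * Real.exp (-(t a + ∑ k ∈ s, t k)) := by
        rw [← Real.exp_add]; congr 1; ring
      rw [h4, ← add_one_mul]
      exact mul_le_mul_of_nonneg_right (Real.add_one_le_exp _) (Real.exp_pos _).le
    linarith

/-- The Herglotz kernel of the point `a`, weighted by `1 - ‖a‖ ^ 2`. -/
def herglotz (a : 𝔻) (z : ℂ) : ℂ :=
  ((1 - ‖(a : ℂ)‖ ^ 2 : ℝ) : ℂ) * ((1 + conj (a : ℂ) * z) / (1 - conj (a : ℂ) * z))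

theorem one_sub_conj_mul_ne_zero (a : 𝔻) {z : ℂ} (hz : ‖z‖ < 1) : 1 - conj (a : ℂ) * z ≠ 0 := by
  simpa [sub_eq_add_neg] using
    one_add_conj_mul_ne_zero (a := -a) (by simpa using a.norm_lt_one.le) hz

theorem herglotz_re (a z : 𝔻) : (herglotz a z).re =
    (1 - ‖(a : ℂ)‖ ^ 2) * (1 - ‖(a : ℂ)‖ ^ 2 * ‖(z : ℂ)‖ ^ 2) /
      ‖1 - conj (a : ℂ) * z‖ ^ 2 := by
  have h := one_sub_conj_mul_ne_zero a z.norm_lt_one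
  have h1 : ((1 + conj (a : ℂ) * z) / (1 - conj (a : ℂ) * z)).re =
      (1 - ‖(a : ℂ)‖ ^ 2 * ‖(z : ℂ)‖ ^ 2) / ‖1 - conj (a : ℂ) * z‖ ^ 2 := by
    rw [div_re, ← add_div]
    simp only [← normSq_eq_norm_sq, normSq_apply, add_re, add_im, sub_re, sub_im, mul_re, mul_im,
      conj_re, conj_im, one_re, one_im]
    congr 1
    ring
  rw [herglotz, re_ofReal_mul, h1, mul_div_assoc]

theorem herglotz_re_nonneg (a z : 𝔻) : 0 ≤ (herglotz a z).re := by
  rw [herglotz_re]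
  have ha := a.sq_norm_lt_one
  have hz := z.sq_norm_lt_one
  have : 0 ≤ 1 - ‖(a : ℂ)‖ ^ 2 * ‖(z : ℂ)‖ ^ 2 := by nlinarith [sq_nonneg ‖(a : ℂ)‖]
  have : 0 ≤ 1 - ‖(a : ℂ)‖ ^ 2 := by linarith
  positivity

/-- Among points at least as far from the origin as `z`, the weighted Poisson kernels at `z` are
controlled by Carleson's condition. -/
theorem herglotz_re_le {a z : 𝔻} (h : ‖(z : ℂ)‖ ≤ ‖(a : ℂ)‖) :
    (herglotz a z).re ≤ 2 * (1 - pseudoDist z a ^ 2) := by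
  have ha := a.sq_norm_lt_one
  have hz := z.sq_norm_lt_one
  have hza : ‖(z : ℂ)‖ ^ 2 ≤ ‖(a : ℂ)‖ ^ 2 := by gcongr
  rw [herglotz_re, one_sub_pseudoDist_sq, ← mul_div_assoc]
  gcongr ?_ / _
  have : 1 - ‖(a : ℂ)‖ ^ 2 * ‖(z : ℂ)‖ ^ 2 ≤ 2 * (1 - ‖(z : ℂ)‖ ^ 2) := by
    nlinarith [sq_nonneg ‖(z : ℂ)‖]
  nlinarith

theorem differentiableOn_herglotz (a : 𝔻) : DifferentiableOn ℂ (herglotz a) (Metric.ball 0 1) := by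
  refine DifferentiableOn.const_mul (DifferentiableOn.fun_div ?_ ?_ fun z hz =>
    one_sub_conj_mul_ne_zero a (mem_ball_zero_iff.1 hz)) _
  · exact (differentiableOn_id.const_mul _).const_add _
  · exact (differentiableOn_id.const_mul _).const_sub _

open Classical in
/-- The points of `Z` that are at least as far from the origin as `a`. -/
def farther (Z : Finset 𝔻) (a : 𝔻) : Finset 𝔻 := Z.filter fun b : 𝔻 => ‖(a : ℂ)‖ ≤ ‖(b : ℂ)‖

theorem sum_herglotz_mul_exp_le (Z : Finset 𝔻) (z : 𝔻) :
    ∑ a ∈ Z, (herglotz a z).re * Real.exp (-∑ b ∈ farther Z a, (herglotz b z).re) ≤ 1 := by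
  have h1 := sum_mul_exp_neg_le Z (fun b : 𝔻 => ‖(b : ℂ)‖) (fun b : 𝔻 => (herglotz b z).re)
    fun b => herglotz_re_nonneg b z
  have h2 := Real.exp_pos (-∑ b ∈ Z, (herglotz b z).re)
  unfold farther
  convert h1.trans (sub_le_self 1 h2.le) using 5

/-- The kernels of Jones' interpolation formula: they are bounded together with their sum, and their
values on the diagonal are bounded below. -/
theorem exists_jones_kernel (Z : Finset 𝔻) {δ : ℝ} (h : UniformlySeparated (Z : Set 𝔻) δ) (a : 𝔻)
    (ha : a ∈ Z) : ∃ f : Hinf, δ ^ 4 * Real.exp (-2) ≤ ‖f.1 a‖ ∧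
      ∀ z : 𝔻, ‖f.1 z‖ ≤ (herglotz a z).re *
        Real.exp (-∑ b ∈ farther Z a, (herglotz b z).re) := by
  classical
  let G : ℂ → ℂ := fun z => (((1 - ‖(a : ℂ)‖ ^ 2 : ℝ) : ℂ) / (1 - conj (a : ℂ) * z)) ^ 2 *
    Complex.exp (-∑ b ∈ farther Z a, herglotz b z)
  have hG : DifferentiableOn ℂ G (Metric.ball 0 1) := by
    refine DifferentiableOn.fun_mul (DifferentiableOn.fun_pow (DifferentiableOn.fun_div
      (differentiableOn_const _) ?_ fun z hz =>
        one_sub_conj_mul_ne_zero a (mem_ball_zero_iff.1 hz)) 2) ?_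
    · exact (differentiableOn_id.const_mul _).const_sub _
    · exact (DifferentiableOn.fun_sum fun b _ => differentiableOn_herglotz b).fun_neg.cexp
  have ha1 := a.sq_norm_lt_one
  have hnorm : ∀ z : 𝔻, ‖G z‖ = (1 - ‖(a : ℂ)‖ ^ 2) ^ 2 / ‖1 - conj (a : ℂ) * z‖ ^ 2 *
      Real.exp (-∑ b ∈ farther Z a, (herglotz b z).re) := fun z => by
    simp only [G]
    rw [norm_mul, norm_pow, norm_div, norm_real, Real.norm_of_nonneg (sub_nonneg.2 ha1.le),
      div_pow, norm_exp, neg_re, re_sum]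
  have hle : ∀ z : 𝔻, ‖G z‖ ≤ (herglotz a z).re *
      Real.exp (-∑ b ∈ farther Z a, (herglotz b z).re) := fun z => by
    have hz1 := z.sq_norm_lt_one
    rw [hnorm, herglotz_re a z]
    refine mul_le_mul_of_nonneg_right ?_ (Real.exp_pos _).le
    gcongr ?_ / _
    rw [sq]
    have : 1 - ‖(a : ℂ)‖ ^ 2 ≤ 1 - ‖(a : ℂ)‖ ^ 2 * ‖(z : ℂ)‖ ^ 2 := by
      nlinarith [sq_nonneg ‖(a : ℂ)‖]
    exact mul_le_mul_of_nonneg_left this (sub_nonneg.2 ha1.le)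
  obtain ⟨f, -, hf⟩ := exists_Hinf hG (C := 1) fun z => by
    refine (hle z).trans ?_
    have h2 := Finset.single_le_sum (f := fun c : 𝔻 => (herglotz c z).re *
      Real.exp (-∑ b ∈ farther Z c, (herglotz b z).re))
      (fun b _ => mul_nonneg (herglotz_re_nonneg b z) (Real.exp_pos _).le) ha
    exact h2.trans (sum_herglotz_mul_exp_le Z z)
  refine ⟨f, ?_, fun z => by rw [hf]; exact hle z⟩
  have hsum : ∑ b ∈ farther Z a, (herglotz b a).re ≤ 2 * (1 - 2 * Real.log δ) := by
    have h1 := sum_one_sub_sq_le (fun w _ => pseudoDist_nonneg a w) h.1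
      (h.2 a ha (Z.erase a) fun z hz => by
        rw [Finset.mem_coe, Finset.mem_erase] at hz
        exact ⟨hz.2, hz.1⟩)
    calc ∑ b ∈ farther Z a, (herglotz b a).re
        ≤ ∑ b ∈ farther Z a, 2 * (1 - pseudoDist a b ^ 2) :=
          Finset.sum_le_sum fun b hb => herglotz_re_le (Finset.mem_filter.1 hb).2
      _ ≤ ∑ b ∈ Z, 2 * (1 - pseudoDist a b ^ 2) :=
          Finset.sum_le_sum_of_subset_of_nonneg (Finset.filter_subset _ _) fun b _ _ => by
            have h2 := pseudoDist_lt_one a b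
            have h3 := pseudoDist_nonneg a b
            nlinarith
      _ ≤ 2 * (1 - 2 * Real.log δ) := by
          rw [← Finset.mul_sum, ← Finset.add_sum_erase _ _ ha, pseudoDist_self]
          linarith
  have hdiag : 1 - conj (a : ℂ) * a = ((1 - ‖(a : ℂ)‖ ^ 2 : ℝ) : ℂ) := by
    rw [← normSq_eq_conj_mul_self, normSq_eq_norm_sq]; push_cast; ring
  rw [hf, hnorm, hdiag, norm_real, Real.norm_of_nonneg (sub_nonneg.2 ha1.le),
    div_self (pow_pos (sub_pos.2 ha1) 2).ne', one_mul]
  have h4 : δ ^ 4 = Real.exp (4 * Real.log δ) := by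
    rw [mul_comm, Real.exp_mul, Real.exp_log h.1]
    norm_cast
  rw [h4, ← Real.exp_add]
  apply Real.exp_le_exp.2
  linarith

/-- The interpolation constant of a uniformly separated set. -/
def interpConst (δ : ℝ) : ℝ := Real.exp 2 / δ ^ 5

theorem UniformlySeparated.interpConst_pos {S : Set 𝔻} {δ : ℝ} (h : UniformlySeparated S δ) :
    0 < interpConst δ := by
  have := h.1
  unfold interpConst
  positivity

theorem exists_interpolation_finset (Z : Finset 𝔻) {δ : ℝ}
    (h : UniformlySeparated (Z : Set 𝔻) δ) (v : 𝔻 → ℂ) {A : ℝ} (hA : 0 ≤ A)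
    (hv : ∀ z ∈ Z, ‖v z‖ ≤ A) :
    ∃ f : Hinf, BoundedBy f (A * interpConst δ) ∧ ∀ z ∈ Z, f.1 z = v z := by
  classical
  have hδ := h.1
  choose! k hk hkz using exists_jones_kernel Z h
  let b : 𝔻 → Hinf := fun a => finiteBlaschke (Z.erase a)
  have hb : ∀ a ∈ Z, δ ≤ ‖(b a).1 a‖ := fun a ha => by
    rw [norm_finiteBlaschke_apply]
    refine h.2 a ha _ fun z hz => ?_
    rw [Finset.mem_coe, Finset.mem_erase] at hz
    exact ⟨hz.2, hz.1⟩
  have hk0 : ∀ a ∈ Z, (k a).1 a ≠ 0 := fun a ha =>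
    norm_pos_iff.1 (lt_of_lt_of_le (by positivity) (hk a ha))
  have hb0 : ∀ a ∈ Z, (b a).1 a ≠ 0 := fun a ha => norm_pos_iff.1 (hδ.trans_le (hb a ha))
  let c : 𝔻 → ℂ := fun a => v a / ((b a).1 a * (k a).1 a)
  have hc : ∀ a ∈ Z, ‖c a‖ ≤ A * interpConst δ := fun a ha => by
    simp only [c]
    rw [norm_div, norm_mul, interpConst, ← mul_div_assoc, div_le_div_iff₀
      (mul_pos (norm_pos_iff.2 (hb0 a ha)) (norm_pos_iff.2 (hk0 a ha))) (by positivity)]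
    have h1 : δ ^ 5 ≤ Real.exp 2 * (‖(b a).1 a‖ * ‖(k a).1 a‖) := by
      calc δ ^ 5 = Real.exp 2 * (δ * (δ ^ 4 * Real.exp (-2))) := by
            rw [Real.exp_neg]; field_simp
        _ ≤ _ := by
            gcongr
            · exact hb a ha
            · exact hk a ha
    calc ‖v a‖ * δ ^ 5 ≤ A * (Real.exp 2 * (‖(b a).1 a‖ * ‖(k a).1 a‖)) :=
          mul_le_mul (hv a ha) h1 (by positivity) hA
      _ = _ := by ring
  refine ⟨∑ a ∈ Z, algebraMap ℂ Hinf (c a) * (b a * k a), fun z => ?_, fun z hz => ?_⟩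
  · rw [Hinf_sum_apply]
    have hC := mul_nonneg hA h.interpConst_pos.le
    calc ‖∑ a ∈ Z, (algebraMap ℂ Hinf (c a) * (b a * k a)).1 z‖
        ≤ ∑ a ∈ Z, A * interpConst δ * ((herglotz a z).re *
          Real.exp (-∑ b ∈ farther Z a, (herglotz b z).re)) := by
          refine norm_sum_le_of_le _ fun a ha => ?_
          rw [Hinf_mul_apply, Hinf_mul_apply, Hinf_algebraMap_apply, norm_mul, norm_mul]
          refine mul_le_mul (hc a ha) ?_ (by positivity) hC
          refine (mul_le_of_le_one_left (norm_nonneg _) (boundedBy_finiteBlaschke _ z)).trans ?_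
          exact hkz a ha z
      _ ≤ A * interpConst δ * 1 := by
          rw [← Finset.mul_sum]
          exact mul_le_mul_of_nonneg_left (sum_herglotz_mul_exp_le Z z) hC
      _ = _ := mul_one _
  · rw [Hinf_sum_apply, Finset.sum_eq_single_of_mem z hz]
    · rw [Hinf_mul_apply, Hinf_mul_apply, Hinf_algebraMap_apply]
      exact div_mul_cancel₀ _ (mul_ne_zero (hb0 z hz) (hk0 z hz))
    · intro a _ haz
      have : (b a).1 z = 0 := by
        rw [← norm_eq_zero, norm_finiteBlaschke_apply]
        exact Finset.prod_eq_zero (Finset.mem_erase.2 ⟨haz.symm, hz⟩) (pseudoDist_self z)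
      rw [Hinf_mul_apply, Hinf_mul_apply, this, zero_mul, mul_zero]

/-- Carleson's interpolation theorem for uniformly separated sets. -/
theorem UniformlySeparated.exists_interpolation {S : Set 𝔻} {δ : ℝ} (h : UniformlySeparated S δ)
    (v : 𝔻 → ℂ) {A : ℝ} (hA : 0 ≤ A) (hv : ∀ z ∈ S, ‖v z‖ ≤ A) :
    ∃ f : Hinf, BoundedBy f (A * interpConst δ) ∧ ∀ z ∈ S, f.1 z = v z := by
  choose G hG hGv using fun F : Finset S => exists_interpolation_finset (toDisc F)
    (h.mono (toDisc_subset F)) v hA fun z hz => hv z (toDisc_subset F hz)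
  obtain ⟨f, hf, hfG⟩ := exists_Hinf_tendsto (exhaustion S) hG
  refine ⟨f, hf, fun z hz => ?_⟩
  refine tendsto_nhds_unique ((hfG z).congr' ?_) tendsto_const_nhds
  filter_upwards [eventually_subset_toDisc {z} (by
    rw [Finset.coe_singleton]; exact Set.singleton_subset_iff.2 hz)] with F hF
  exact hGv F z (Finset.singleton_subset_iff.1 hF)

/-! ### Functions with separated zeros -/

/-- Off a pseudohyperbolic neighbourhood of a uniformly separated set, its Blaschke product is
bounded below: if `f` interpolates the reciprocal of the Blaschke factor `b` of `z`, then
`1 - b * f` is divisible by the Blaschke product and takes the value `1` at `z`. -/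
theorem UniformlySeparated.le_norm_blaschke_of_le_pseudoDist {S : Set 𝔻} {δ : ℝ}
    (h : UniformlySeparated S δ) {z : 𝔻} {ε : ℝ} (hε : 0 < ε)
    (hz : ∀ s ∈ S, ε ≤ pseudoDist z s) :
    ε / (ε + interpConst δ) ≤ ‖(blaschke S).1 z‖ := by
  have hM := h.interpConst_pos
  obtain ⟨f, hf, hfv⟩ := h.exists_interpolation (fun s => ((blaschkeFactor z).1 s)⁻¹)
    (A := ε⁻¹) (by positivity) fun s hs => by
      rw [norm_inv, norm_blaschkeFactor_apply, pseudoDist_comm]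
      exact inv_anti₀ hε (hz s hs)
  have hbound : BoundedBy (1 - blaschkeFactor z * f) (1 + ε⁻¹ * interpConst δ) := fun u => by
    rw [Hinf_sub_apply, Hinf_one_apply, Hinf_mul_apply]
    refine (norm_sub_le _ _).trans ?_
    rw [norm_one, norm_mul]
    exact add_le_add le_rfl ((mul_le_of_le_one_left (norm_nonneg _) (boundedBy_blaschkeFactor z u)).trans (hf u))
  obtain ⟨k, hk, hfk⟩ := exists_eq_blaschke_mul hbound (S := S) fun s hs => by
    have hne : (blaschkeFactor z).1 s ≠ 0 := blaschkeFactor_ne_zero fun hsz => by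
      have := hz s hs
      rw [hsz, pseudoDist_self] at this
      linarith
    rw [Hinf_sub_apply, Hinf_one_apply, Hinf_mul_apply, hfv s hs, mul_inv_cancel₀ hne, sub_self]
  have h1 : (1 : ℂ) = (blaschke S).1 z * k.1 z := by
    have := congrArg (fun F : Hinf => F.1 z) hfk
    rwa [Hinf_sub_apply, Hinf_one_apply, Hinf_mul_apply, Hinf_mul_apply, blaschkeFactor_self,
      zero_mul, sub_zero] at this
  have h2 : 1 ≤ ‖(blaschke S).1 z‖ * (1 + ε⁻¹ * interpConst δ) := by
    calc (1 : ℝ) = ‖(blaschke S).1 z‖ * ‖k.1 z‖ := by rw [← norm_mul, ← h1, norm_one]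
      _ ≤ _ := mul_le_mul_of_nonneg_left (hk z) (norm_nonneg _)
  rw [div_le_iff₀ (by positivity)]
  calc ε = ε * 1 := (mul_one ε).symm
    _ ≤ ε * (‖(blaschke S).1 z‖ * (1 + ε⁻¹ * interpConst δ)) := by gcongr
    _ = _ := by field_simp

/-- The zeros of the Blaschke product of a uniformly separated set are simple, quantitatively. -/
theorem UniformlySeparated.exists_blaschke_eq {S : Set 𝔻} {δ : ℝ} (h : UniformlySeparated S δ)
    {s : 𝔻} (hs : s ∈ S) :
    ∃ H : Hinf, BoundedBy H 1 ∧ δ ≤ ‖H.1 s‖ ∧ blaschke S = blaschkeFactor s * H := by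
  obtain ⟨H, hH, hBH⟩ := exists_eq_blaschkeFactor_mul (boundedBy_blaschke S)
    (blaschke_apply_eq_zero hs)
  refine ⟨H, hH, ?_, hBH⟩
  have hb : BoundedBy (blaschkeFactor s * blaschke (S \ {s})) 1 := fun z => by
    rw [Hinf_mul_apply, norm_mul]
    exact mul_le_one₀ (boundedBy_blaschkeFactor s z) (norm_nonneg _) (boundedBy_blaschke _ z)
  obtain ⟨k, hk, hbk⟩ := exists_eq_blaschke_mul hb (S := S) fun a ha => by
    rw [Hinf_mul_apply]
    by_cases has : a = s
    · rw [has, blaschkeFactor_self, zero_mul]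
    · rw [blaschke_apply_eq_zero (S := S \ {s}) ⟨ha, has⟩, mul_zero]
  rw [hBH, mul_assoc] at hbk
  have h1 := blaschkeFactor_mul_cancel hbk
  calc δ ≤ ‖(blaschke (S \ {s})).1 s‖ := le_norm_blaschke fun F hF => h.2 s hs F hF
    _ = ‖H.1 s‖ * ‖k.1 s‖ := by rw [h1, Hinf_mul_apply, norm_mul]
    _ ≤ ‖H.1 s‖ := mul_le_of_le_one_right (norm_nonneg _) (hk s)

/-- Within pseudohyperbolic distance `ε` of `z`, the function `g` has a zero `s` at which the
quotient of `g` by the Blaschke factor of `s` is bounded below by `δ`. -/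
def NearSimpleZero (g : Hinf) (ε δ : ℝ) (z : 𝔻) : Prop :=
  ∃ t : 𝔻, ‖(t : ℂ)‖ ≤ ε ∧ ∃ H : Hinf, BoundedBy H 1 ∧ δ ≤ ‖H.1 (discAut z t)‖ ∧
    ∀ u, ‖g.1 u‖ = pseudoDist u (discAut z t) * ‖H.1 u‖

/-- Every point of the disc is close to a simple zero of `g`, or `g` is large there. Unlike the
representation of `g` by a Blaschke product, this property passes to pointwise limits. -/
def ZerosSeparated (g : Hinf) (c δ : ℝ) : Prop :=
  ∀ z, c ≤ ‖g.1 z‖ ∨ NearSimpleZero g (δ / 4) δ z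

theorem nearSimpleZero_blaschke {S : Set 𝔻} {δ : ℝ} (h : UniformlySeparated S δ) {s z : 𝔻}
    (hs : s ∈ S) {ε : ℝ} (hz : pseudoDist z s ≤ ε) : NearSimpleZero (blaschke S) ε δ z := by
  obtain ⟨H, hH, hHs, hBH⟩ := h.exists_blaschke_eq hs
  refine ⟨discAut (-z) s, by rwa [← pseudoDist_eq, pseudoDist_comm], H, hH, ?_, fun u => ?_⟩
  · rwa [discAut_discAut_neg]
  · rw [discAut_discAut_neg, hBH, Hinf_mul_apply, norm_mul, norm_blaschkeFactor_apply]

/-- The lower bound for a Blaschke product with separation constant `δ` at the points that are at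
distance at least `δ / 4` from its zeros. -/
def lowerConst (δ : ℝ) : ℝ := δ / 4 / (δ / 4 + interpConst δ)

theorem UniformlySeparated.lowerConst_pos {S : Set 𝔻} {δ : ℝ} (h : UniformlySeparated S δ) :
    0 < lowerConst δ := by
  have := h.1
  have := h.interpConst_pos
  unfold lowerConst
  positivity

theorem UniformlySeparated.zerosSeparated_blaschke {S : Set 𝔻} {δ : ℝ}
    (h : UniformlySeparated S δ) : ZerosSeparated (blaschke S) (lowerConst δ) δ := fun z => by
  by_cases hz : ∀ s ∈ S, δ / 4 ≤ pseudoDist z s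
  · exact Or.inl (h.le_norm_blaschke_of_le_pseudoDist (by linarith [h.1]) hz)
  · push Not at hz
    obtain ⟨s, hs, hzs⟩ := hz
    exact Or.inr (nearSimpleZero_blaschke h hs hzs.le)

theorem NearSimpleZero.compAut {g : Hinf} {ε δ : ℝ} {w z : 𝔻}
    (h : NearSimpleZero g ε δ (discAut w z)) : NearSimpleZero (compAut w g) ε δ z := by
  obtain ⟨t, ht, H, hH, hHt, hgH⟩ := h
  set s := discAut (discAut w z) t with hs
  have hst : pseudoDist s (discAut w z) = ‖(t : ℂ)‖ := pseudoDist_discAut_left _ _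
  have hs' : discAut w (discAut (-w) s) = s := discAut_discAut_neg w s
  refine ⟨discAut (-z) (discAut (-w) s), ?_, HoffmanMaps.compAut w H, hH.compAut w, ?_,
    fun u => ?_⟩
  · rwa [← pseudoDist_eq, ← pseudoDist_discAut w, hs', hst]
  · rwa [discAut_discAut_neg, compAut_apply, hs']
  · rw [discAut_discAut_neg, compAut_apply, compAut_apply, hgH, ← hs', pseudoDist_discAut, hs']

theorem ZerosSeparated.compAut {g : Hinf} {c δ : ℝ} (h : ZerosSeparated g c δ) (w : 𝔻) :
    ZerosSeparated (compAut w g) c δ := fun z => by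
  rcases h (discAut w z) with h | h
  · exact Or.inl (by rwa [compAut_apply])
  · exact Or.inr h.compAut

theorem ZerosSeparated.of_tendsto {ι : Type*} {U : Ultrafilter ι} {F : ι → Hinf} {g : Hinf}
    {c δ : ℝ} (hδ0 : 0 < δ) (hδ1 : δ ≤ 1) (hF : ∀ i, ZerosSeparated (F i) c δ)
    (hg : ∀ z, Tendsto (fun i => (F i).1 z) U (𝓝 (g.1 z))) : ZerosSeparated g c δ := fun z => by
  by_cases hc : ∀ᶠ i in (U : Filter ι), c ≤ ‖(F i).1 z‖
  · exact Or.inl (ge_of_tendsto (hg z).norm hc)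
  right
  have hnear : ∀ᶠ i in (U : Filter ι), NearSimpleZero (F i) (δ / 4) δ z :=
    (Ultrafilter.eventually_not.2 hc).mono fun i hi => (hF i z).resolve_left hi
  have hch : ∀ i, ∃ t : 𝔻, ∃ H : Hinf, BoundedBy H 1 ∧ ‖(t : ℂ)‖ ≤ δ / 4 ∧
      (NearSimpleZero (F i) (δ / 4) δ z → δ ≤ ‖H.1 (discAut z t)‖ ∧
        ∀ u, ‖(F i).1 u‖ = pseudoDist u (discAut z t) * ‖H.1 u‖) := fun i => by
    by_cases hi : NearSimpleZero (F i) (δ / 4) δ z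
    · obtain ⟨t, ht, H, hH, hrest⟩ := hi
      exact ⟨t, H, hH, ht, fun _ => hrest⟩
    · refine ⟨0, 1, fun u => ?_, ?_, fun h => absurd h hi⟩
      · rw [Hinf_one_apply, norm_one]
      · rw [UnitDisc.coe_zero, norm_zero]; positivity
  choose t H hH ht hrest using hch
  obtain ⟨H', hH', hHlim⟩ := exists_Hinf_tendsto U hH
  obtain ⟨t', ht', htlim⟩ := exists_tendsto_of_norm_le U (Eventually.of_forall ht)
  lift t' to 𝔻 using by linarith
  have hs := tendsto_discAut (tendsto_const_nhds (x := z)) (tendsto_coe_iff.1 htlim)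
  refine ⟨t', ht', H', hH', ?_, fun u => ?_⟩
  · refine ge_of_tendsto (tendsto_apply_of_tendsto hH hs (hHlim _)).norm ?_
    filter_upwards [hnear] with i hi using (hrest i hi).1
  · refine tendsto_nhds_unique (hg u).norm (((tendsto_pseudoDist (tendsto_const_nhds (x := u))
      hs).mul (hHlim u).norm).congr' ?_)
    filter_upwards [hnear] with i hi using ((hrest i hi).2 u).symm

/-- The zero set of `g` in the disc. -/
def zeroSet (g : Hinf) : Set 𝔻 := {z | g.1 z = 0}

theorem half_le_norm_apply {H : Hinf} (hH : BoundedBy H 1) {δ : ℝ} {z t : 𝔻}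
    (ht : ‖(t : ℂ)‖ ≤ δ / 4) (hHt : δ ≤ ‖H.1 (discAut z t)‖) : δ / 2 ≤ ‖H.1 z‖ := by
  have h1 := norm_apply_discAut_sub_le hH z t
  have h2 := norm_sub_norm_le (H.1 (discAut z t)) (H.1 z)
  linarith

theorem ZerosSeparated.exists_eq_at_zero {g : Hinf} {c δ : ℝ} (hc : 0 < c) (hδ : 0 < δ)
    (h : ZerosSeparated g c δ) {z : 𝔻} (hz : g.1 z = 0) :
    ∃ H : Hinf, BoundedBy H 1 ∧ δ ≤ ‖H.1 z‖ ∧ ∀ u, ‖g.1 u‖ = pseudoDist u z * ‖H.1 u‖ := by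
  have h0 : ¬ c ≤ ‖g.1 z‖ := by rw [hz, norm_zero]; exact not_le.2 hc
  obtain ⟨t, ht, H, hH, hHt, hgH⟩ := (h z).resolve_left h0
  have hHz := half_le_norm_apply hH ht hHt
  have hzt : z = discAut z t := by
    by_contra hne
    have h1 := hgH z
    rw [hz, norm_zero] at h1
    have := mul_pos (pseudoDist_pos hne) (lt_of_lt_of_le (by linarith) hHz)
    linarith
  rw [← hzt] at hHt hgH
  exact ⟨H, hH, hHt, hgH⟩

theorem ZerosSeparated.uniformlySeparated {g : Hinf} {c δ : ℝ} (hc : 0 < c) (hδ : 0 < δ)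
    (h : ZerosSeparated g c δ) : UniformlySeparated (zeroSet g) δ := by
  refine ⟨hδ, fun z hz F hF => ?_⟩
  obtain ⟨H, hH, hHz, hgH⟩ := h.exists_eq_at_zero hc hδ hz
  obtain ⟨k, hk, hHk⟩ := exists_eq_finiteBlaschke_mul F hH fun w hw => by
    have h1 := hgH w
    have hgw : g.1 w = 0 := (hF hw).1
    rw [hgw, norm_zero] at h1
    exact norm_eq_zero.1
      ((mul_eq_zero.1 h1.symm).resolve_left (pseudoDist_pos (hF hw).2).ne')
  calc δ ≤ ‖H.1 z‖ := hHz
    _ = (∏ w ∈ F, pseudoDist z w) * ‖k.1 z‖ := by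
      rw [hHk, Hinf_mul_apply, norm_mul, norm_finiteBlaschke_apply]
    _ ≤ _ := mul_le_of_le_one_right (prod_pseudoDist_nonneg F z) (hk z)

theorem exists_inverse {k : Hinf} {c : ℝ} (hc : 0 < c) (hk : ∀ z, c ≤ ‖k.1 z‖) :
    ∃ k' : Hinf, k * k' = 1 := by
  obtain ⟨K, hK, hKk⟩ := k.2
  have hne : ∀ z, k.1 z ≠ 0 := fun z => norm_pos_iff.1 (hc.trans_le (hk z))
  obtain ⟨k', -, hk'⟩ := exists_Hinf (G := fun z => (K z)⁻¹) (C := c⁻¹)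
    (hK.fun_inv fun z hz => by
      lift z to 𝔻 using mem_ball_zero_iff.1 hz
      rw [hKk]; exact hne z)
    fun z => by
      rw [hKk, norm_inv]
      exact inv_anti₀ hc (hk z)
  refine ⟨k', Hinf_ext fun z => ?_⟩
  rw [Hinf_mul_apply, hk', hKk, Hinf_one_apply]
  exact mul_inv_cancel₀ (hne z)

/-- A function with separated zeros is the Blaschke product of its zeros times a unit of `H^∞`. -/
theorem ZerosSeparated.exists_eq_blaschke_mul_unit {g : Hinf} {c δ : ℝ} (hc : 0 < c) (hδ : 0 < δ)
    (hg : BoundedBy g 1) (h : ZerosSeparated g c δ) :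
    ∃ k k' : Hinf, g = blaschke (zeroSet g) * k ∧ k * k' = 1 := by
  obtain ⟨k, hk, hgk⟩ := exists_eq_blaschke_mul hg (S := zeroSet g) fun a ha => ha
  have hgz : ∀ z, ‖g.1 z‖ = ‖(blaschke (zeroSet g)).1 z‖ * ‖k.1 z‖ := fun z => by
    rw [← norm_mul, ← Hinf_mul_apply, ← hgk]
  obtain ⟨k', hk'⟩ := exists_inverse (k := k) (c := min c (δ / 2)) (by positivity) fun z => by
    rcases h z with h | ⟨t, ht, H, hH, hHt, hgH⟩
    · refine (min_le_left _ _).trans (h.trans ?_)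
      rw [hgz]
      exact mul_le_of_le_one_left (norm_nonneg _) (boundedBy_blaschke _ z)
    · refine (min_le_right _ _).trans ((half_le_norm_apply hH ht hHt).trans ?_)
      set s := discAut z t
      have hs : s ∈ zeroSet g := by
        have := hgH s
        rwa [pseudoDist_self, zero_mul, norm_eq_zero] at this
      have hne : ∀ u, u ≠ s → ‖H.1 u‖ ≤ ‖k.1 u‖ := fun u hu => by
        have h1 := (hgz u).symm.trans (hgH u)
        have h2 := mul_le_mul_of_nonneg_right (norm_blaschke_le_pseudoDist hs u)
          (norm_nonneg (k.1 u))
        rw [h1] at h2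
        exact le_of_mul_le_mul_left h2 (pseudoDist_pos hu)
      by_cases hzs : z = s
      · rw [hzs]; exact Hinf_norm_le_of_forall_ne hne
      · exact hne z hzs
  exact ⟨k, k', hgk, hk'⟩

/-! ### Points of the maximal ideal space -/

theorem isInducing_eval : IsInducing fun (ξ : MaxIdealSpace) (f : Hinf) => ξ f :=
  (show IsInducing fun (φ : WeakDual ℂ Hinf) (f : Hinf) => φ f from ⟨rfl⟩).comp .subtypeVal

theorem continuous_eval (f : Hinf) : Continuous fun ξ : MaxIdealSpace => ξ f :=
  (continuous_apply f).comp isInducing_eval.continuous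

theorem tendsto_iff_eval {ι : Type*} {l : Filter ι} {u : ι → MaxIdealSpace} {x : MaxIdealSpace} :
    Tendsto u l (𝓝 x) ↔ ∀ f, Tendsto (fun i => u i f) l (𝓝 (x f)) := by
  rw [isInducing_eval.tendsto_nhds_iff, tendsto_pi_nhds]
  rfl

/-- Every zero in the maximal ideal space of the Blaschke product of a uniformly separated set `S`
is in the closure of `S`: if finitely many `f i`, vanishing at `ξ`, have no common approximate zero
on `S`, then by interpolation `1 - ∑ f i * g i` vanishes on `S` for suitable `g i`, and hence it
vanishes at `ξ`. -/
theorem UniformlySeparated.mem_closure {S : Set 𝔻} {δ : ℝ} (h : UniformlySeparated S δ)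
    {ξ : MaxIdealSpace} (hξ : ξ (blaschke S) = 0) : ξ ∈ closure (ofDisc '' S) := by
  classical
  by_contra hcl
  rw [isInducing_eval.closure_eq_preimage_closure_image, Set.mem_preimage] at hcl
  obtain ⟨I, u, hu, hsub⟩ := isOpen_pi_iff.1 isClosed_closure.isOpen_compl _ hcl
  have hball : ∀ f : Hinf, ∃ e > 0, f ∈ I → Metric.ball (ξ f) e ⊆ u f := fun f => by
    by_cases hf : f ∈ I
    · obtain ⟨e, he, hb⟩ := Metric.isOpen_iff.1 (hu f hf).1 _ (hu f hf).2
      exact ⟨e, he, fun _ => hb⟩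
    · exact ⟨1, one_pos, fun h => absurd h hf⟩
  choose e he hball using hball
  have hfar : ∀ z ∈ S, ∃ f ∈ I, e f ≤ ‖f.1 z - ξ f‖ := fun z hz => by
    by_contra! hcon
    refine hsub (a := fun f => ofDisc z f) (fun f hf => hball f hf ?_)
      (subset_closure ⟨ofDisc z, ⟨z, hz, rfl⟩, rfl⟩)
    exact mem_ball_iff_norm.2 (hcon f hf)
  choose! i hiI hi using hfar
  have hint : ∀ f : Hinf, ∃ g : Hinf, ∀ z ∈ S,
      g.1 z = if f = i z then (f.1 z - ξ f)⁻¹ else 0 := fun f => by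
    obtain ⟨g, -, hg⟩ := h.exists_interpolation
      (fun z => if f = i z then (f.1 z - ξ f)⁻¹ else 0) (A := (e f)⁻¹)
      (inv_nonneg.2 (he f).le) fun z hz => by
        split_ifs with hf
        · rw [norm_inv]
          have := hi z hz
          rw [← hf] at this
          exact inv_anti₀ (he f) this
        · rw [norm_zero]; exact inv_nonneg.2 (he f).le
    exact ⟨g, hg⟩
  choose g hg using hint
  let N : Hinf := 1 - ∑ f ∈ I, (f - algebraMap ℂ Hinf (ξ f)) * g f
  obtain ⟨C, hC⟩ := exists_boundedBy N
  obtain ⟨k, -, hk⟩ := exists_eq_blaschke_mul hC (S := S) fun z hz => by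
    simp only [N]
    rw [Hinf_sub_apply, Hinf_one_apply, Hinf_sum_apply, Finset.sum_eq_single_of_mem _ (hiI z hz)]
    · rw [Hinf_mul_apply, Hinf_sub_apply, Hinf_algebraMap_apply, hg _ z hz, if_pos rfl,
        mul_inv_cancel₀ (norm_pos_iff.1 ((he _).trans_le (hi z hz))), sub_self]
    · intro f _ hf
      rw [Hinf_mul_apply, hg _ z hz, if_neg hf, mul_zero]
  have h1 : ξ N = 1 := by
    simp only [N]
    rw [map_sub, map_one, map_sum, Finset.sum_eq_zero, sub_zero]
    intro f _
    rw [map_mul, map_sub, AlgHomClass.commutes]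
    simp
  rw [hk, map_mul, hξ, zero_mul] at h1
  exact zero_ne_one h1

/-- A point of the maximal ideal space at which a function with separated zeros vanishes is in the
closure of an interpolating sequence. -/
theorem ZerosSeparated.mem_goodPoints {g : Hinf} {c δ : ℝ} (hc : 0 < c) (hδ : 0 < δ)
    (hg : BoundedBy g 1) (h : ZerosSeparated g c δ) {ξ : MaxIdealSpace} (hξ : ξ g = 0) :
    ξ ∈ goodPoints := by
  have hsep := h.uniformlySeparated hc hδ
  obtain ⟨k, k', hgk, hkk'⟩ := h.exists_eq_blaschke_mul_unit hc hδ hg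
  have hk0 : ξ k ≠ 0 := fun h0 => by
    have := congrArg ξ hkk'
    rw [map_mul, h0, zero_mul, map_one] at this
    exact zero_ne_one this
  rw [hgk, map_mul] at hξ
  have hcl := hsep.mem_closure ((mul_eq_zero.1 hξ).resolve_right hk0)
  refine ⟨zeroSet g, isInterpolating_iff.2 ⟨?_, δ, hsep⟩, hcl⟩
  rw [Set.nonempty_iff_ne_empty]
  intro hempty
  rw [hempty, Set.image_empty, closure_empty] at hcl
  exact hcl

/-! ### Hoffman maps of points in the closure of an interpolating sequence -/

theorem UniformlySeparated.min_one {S : Set 𝔻} {δ : ℝ} (h : UniformlySeparated S δ) :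
    UniformlySeparated S (min δ 1) :=
  ⟨lt_min h.1 one_pos, fun z hz F hF => (min_le_left _ _).trans (h.2 z hz F hF)⟩

theorem exists_of_mem_goodPoints {m : MaxIdealSpace} (hm : m ∈ goodPoints) :
    ∃ S δ, UniformlySeparated S δ ∧ δ ≤ 1 ∧ m ∈ closure (ofDisc '' S) := by
  obtain ⟨S, hS, hmS⟩ := hm
  obtain ⟨-, δ, hδ⟩ := isInterpolating_iff.1 hS
  exact ⟨S, min δ 1, hδ.min_one, min_le_right _ _, hmS⟩

theorem mem_goodPoints_of_mem_closure {S : Set 𝔻} {δ : ℝ} (h : UniformlySeparated S δ)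
    {m : MaxIdealSpace} (hm : m ∈ closure (ofDisc '' S)) : m ∈ goodPoints := by
  refine ⟨S, isInterpolating_iff.2 ⟨?_, δ, h⟩, hm⟩
  rw [Set.nonempty_iff_ne_empty]
  rintro rfl
  rw [Set.image_empty, closure_empty] at hm
  exact hm

theorem ofDisc_mem_goodPoints (a : 𝔻) : ofDisc a ∈ goodPoints := by
  refine mem_goodPoints_of_mem_closure (S := {a}) (δ := 1) ⟨one_pos, fun z hz F hF => ?_⟩
    (subset_closure ⟨a, rfl, rfl⟩)
  rw [Set.mem_singleton_iff.1 hz, sdiff_self] at hF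
  have : F = ∅ := Finset.coe_eq_empty.1 (Set.subset_empty_iff.1 hF)
  rw [this, Finset.prod_empty]

theorem apply_blaschke_eq_zero {S : Set 𝔻} {m : MaxIdealSpace} (hm : m ∈ closure (ofDisc '' S)) :
    m (blaschke S) = 0 := by
  refine closure_minimal (t := {ξ : MaxIdealSpace | ξ (blaschke S) = 0}) ?_
    (isClosed_eq (continuous_eval _) continuous_const) hm
  rintro _ ⟨s, hs, rfl⟩
  exact blaschke_apply_eq_zero hs

theorem tendsto_ofDisc (m : MaxIdealSpace) : Tendsto ofDisc (discNhds m) (𝓝 m) := tendsto_comap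

theorem tendsto_apply_discNhds (m : MaxIdealSpace) (f : Hinf) :
    Tendsto (fun w => f.1 w) (discNhds m) (𝓝 (m f)) :=
  tendsto_iff_eval.1 (tendsto_ofDisc m) f

theorem tendsto_discNhds_iff {ι : Type*} {l : Filter ι} {u : ι → 𝔻} {m : MaxIdealSpace} :
    Tendsto u l (discNhds m) ↔ Tendsto (fun i => ofDisc (u i)) l (𝓝 m) := tendsto_comap_iff

theorem discNhds_inf_principal_neBot {S : Set 𝔻} {m : MaxIdealSpace}
    (hm : m ∈ closure (ofDisc '' S)) : (discNhds m ⊓ 𝓟 S).NeBot := by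
  rw [inf_principal_neBot_iff]
  rintro U ⟨V, hV, hVU⟩
  obtain ⟨_, hxV, s, hs, rfl⟩ := mem_closure_iff_nhds.1 hm V hV
  exact ⟨s, hVU hxV, hs⟩

theorem discNhds_neBot {m : MaxIdealSpace} (hm : m ∈ goodPoints) : (discNhds m).NeBot := by
  obtain ⟨S, hS, hmS⟩ := hm
  exact (discNhds_inf_principal_neBot hmS).mono inf_le_left

/-- A uniformly separated set has at most one ultrafilter converging to a given point of the maximal
ideal space, since Blaschke products separate its subsets. -/
theorem UniformlySeparated.exists_ultrafilter {S : Set 𝔻} {δ : ℝ} (h : UniformlySeparated S δ)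
    {m : MaxIdealSpace} (hm : m ∈ closure (ofDisc '' S)) :
    ∃ W : Ultrafilter 𝔻, (W : Filter 𝔻) = discNhds m ⊓ 𝓟 S := by
  have hne := discNhds_inf_principal_neBot hm
  have hdich : ∀ A : Set 𝔻, A ∈ discNhds m ⊓ 𝓟 S ∨ Aᶜ ∈ discNhds m ⊓ 𝓟 S := fun A => by
    have hlim := tendsto_apply_discNhds m (blaschke (S ∩ A))
    by_cases h0 : m (blaschke (S ∩ A)) = 0
    · left
      rw [h0] at hlim
      have hlim' := hlim.norm
      rw [norm_zero] at hlim'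
      rw [mem_inf_principal]
      filter_upwards [hlim'.eventually_lt_const h.1] with w hw hwS
      by_contra hwA
      refine hw.not_ge (le_norm_blaschke fun F hF => h.2 w hwS F fun z hz => ?_)
      exact ⟨(hF hz).1, fun hzw => hwA (Set.mem_singleton_iff.1 hzw ▸ (hF hz).2)⟩
    · right
      rw [mem_inf_principal]
      filter_upwards [hlim.eventually_ne h0] with w hw hwS hwA
      exact hw (blaschke_apply_eq_zero ⟨hwS, hwA⟩)
  refine ⟨Ultrafilter.ofComplNotMemIff (discNhds m ⊓ 𝓟 S) fun A =>
    ⟨(hdich A).resolve_right, fun hA hAc => ?_⟩, rfl⟩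
  exact compl_notMem hA hAc

theorem UniformlySeparated.exists_pseudoDist_le {S : Set 𝔻} {δ : ℝ} (h : UniformlySeparated S δ)
    {w : 𝔻} (hw : ‖(blaschke S).1 w‖ < lowerConst δ) :
    ∃ s ∈ S, pseudoDist w s ≤ 2 / δ * ‖(blaschke S).1 w‖ := by
  by_contra! hcon
  have hnot : ¬ ∀ s ∈ S, δ / 4 ≤ pseudoDist w s := fun hall =>
    hw.not_ge (h.le_norm_blaschke_of_le_pseudoDist (by linarith [h.1]) hall)
  push Not at hnot
  obtain ⟨s, hs, hws⟩ := hnot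
  obtain ⟨H, hH, hHs, hB⟩ := h.exists_blaschke_eq hs
  have hHw : δ / 2 ≤ ‖H.1 w‖ := half_le_norm_apply hH (z := w) (t := discAut (-w) s)
    (by rw [← pseudoDist_eq, pseudoDist_comm]; exact hws.le) (by rwa [discAut_discAut_neg])
  have h1 : ‖(blaschke S).1 w‖ = pseudoDist w s * ‖H.1 w‖ := by
    rw [hB, Hinf_mul_apply, norm_mul, norm_blaschkeFactor_apply]
  have h2 := hcon s hs
  have hδ := h.1
  have h3 : pseudoDist w s * (δ / 2) ≤ pseudoDist w s * ‖H.1 w‖ :=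
    mul_le_mul_of_nonneg_left hHw (pseudoDist_nonneg w s)
  have h4 : 2 / δ * (pseudoDist w s * (δ / 2)) = pseudoDist w s := by field_simp
  rw [h1] at h2
  have h5 := mul_le_mul_of_nonneg_left h3 (show (0 : ℝ) ≤ 2 / δ by positivity)
  linarith

/-- Near a point `m` in the closure of a uniformly separated set `S`, the points of the disc are
pseudohyperbolically close to points of `S` that converge to `m` as well. -/
theorem UniformlySeparated.exists_retraction {S : Set 𝔻} {δ : ℝ} (h : UniformlySeparated S δ)
    {m : MaxIdealSpace} (hm : m ∈ closure (ofDisc '' S)) :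
    ∃ s : 𝔻 → 𝔻, Tendsto s (discNhds m) (discNhds m ⊓ 𝓟 S) ∧
      Tendsto (fun w => pseudoDist w (s w)) (discNhds m) (𝓝 0) := by
  have hch : ∀ w, ∃ s, ‖(blaschke S).1 w‖ < lowerConst δ →
      s ∈ S ∧ pseudoDist w s ≤ 2 / δ * ‖(blaschke S).1 w‖ := fun w => by
    by_cases hw : ‖(blaschke S).1 w‖ < lowerConst δ
    · obtain ⟨s, hs⟩ := h.exists_pseudoDist_le hw
      exact ⟨s, fun _ => hs⟩
    · exact ⟨w, fun h => absurd h hw⟩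
  choose s hs using hch
  have hlim := (tendsto_apply_discNhds m (blaschke S)).norm
  rw [apply_blaschke_eq_zero hm, norm_zero] at hlim
  have hev := hlim.eventually_lt_const h.lowerConst_pos
  have hdist : Tendsto (fun w => pseudoDist w (s w)) (discNhds m) (𝓝 0) := by
    have h0 := hlim.const_mul (2 / δ)
    rw [mul_zero] at h0
    exact squeeze_zero' (Eventually.of_forall fun w => pseudoDist_nonneg _ _)
      (hev.mono fun w hw => (hs w hw).2) h0
  refine ⟨s, tendsto_inf.2 ⟨tendsto_discNhds_iff.2 (tendsto_iff_eval.2 fun f => ?_),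
    tendsto_principal.2 (hev.mono fun w hw => (hs w hw).1)⟩, hdist⟩
  obtain ⟨C, hC⟩ := exists_boundedBy f
  have h1 := (tendsto_apply_discNhds m f).sub (tendsto_apply_sub_apply (fun _ => hC) hdist)
  rw [sub_zero] at h1
  exact h1.congr fun w => sub_sub_cancel _ _

theorem tendsto_circle_coe_iff {ι : Type*} {l : Filter ι} {c : ι → Circle} {c₀ : Circle} :
    Tendsto (fun i => (c i : ℂ)) l (𝓝 (c₀ : ℂ)) ↔ Tendsto c l (𝓝 c₀) :=
  (show IsInducing ((↑) : Circle → ℂ) from .subtypeVal).tendsto_nhds_iff.symm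

/-- The maps `w ↦ f (L_w(z))` are uniformly continuous for the pseudohyperbolic distance. -/
theorem tendsto_apply_discAut_sub {ι : Type*} {l : Filter ι} {w s : ι → 𝔻}
    (h : Tendsto (fun i => pseudoDist (w i) (s i)) l (𝓝 0)) (f : Hinf) (z : 𝔻) :
    Tendsto (fun i => f.1 (discAut (w i) z) - f.1 (discAut (s i) z)) l (𝓝 0) := by
  obtain ⟨C, hC⟩ := exists_boundedBy f
  let t : ι → 𝔻 := fun i => discAut (-s i) (w i)
  have ht : Tendsto t l (𝓝 0) := by
    rw [← tendsto_coe_iff, UnitDisc.coe_zero, tendsto_zero_iff_norm_tendsto_zero]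
    exact h.congr fun i => pseudoDist_eq _ _
  have hlam : Tendsto (fun i => lamApprox (ofDisc (s i)) (t i)) l (𝓝 1) := by
    rw [← tendsto_circle_coe_iff, Circle.coe_one]
    have h1 : Tendsto (fun i => conj (s i : ℂ) * t i) l (𝓝 0) := by
      refine squeeze_zero_norm (fun i => ?_)
        (tendsto_zero_iff_norm_tendsto_zero.1 (tendsto_coe_iff.2 ht))
      rw [norm_mul, RCLike.norm_conj]
      exact mul_le_of_le_one_left (norm_nonneg _) (s i).norm_lt_one.le
    have h2 : Tendsto (fun i => (s i : ℂ) * conj (t i : ℂ)) l (𝓝 0) := by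
      have := (continuous_conj.tendsto _).comp h1
      rw [map_zero] at this
      refine this.congr fun i => ?_
      simp
    have h3 := (h1.const_add 1).div (h2.const_add 1) (by norm_num)
    rw [add_zero, div_one] at h3
    exact h3
  have hu : Tendsto (fun i => discAut (t i) (lamApprox (ofDisc (s i)) (t i) • z)) l (𝓝 z) := by
    have := tendsto_discAut ht (tendsto_circle_smul hlam (tendsto_const_nhds (x := z)))
    rwa [one_smul, discAut_zero_left] at this
  have hd := tendsto_pseudoDist hu (tendsto_const_nhds (x := z))
  rw [pseudoDist_self] at hd
  refine (tendsto_apply_sub_apply (F := fun i => compAut (s i) f) (fun i => hC.compAut _)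
    hd).congr fun i => ?_
  rw [compAut_apply, compAut_apply, discAut_discAut_smul, discAut_discAut_neg]

theorem tendsto_hoffman {m : MaxIdealSpace} (hm : m ∈ goodPoints) (z : 𝔻) :
    Tendsto (fun w => ofDisc (discAut w z)) (discNhds m) (𝓝 (hoffman m z)) := by
  refine tendsto_nhds_limUnder ?_
  obtain ⟨S, δ, hS, -, hmS⟩ := exists_of_mem_goodPoints hm
  obtain ⟨W, hW⟩ := hS.exists_ultrafilter hmS
  obtain ⟨s, hs, hdist⟩ := hS.exists_retraction hmS
  let y : MaxIdealSpace := (W.map fun w => ofDisc (discAut w z)).lim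
  have hy : Tendsto (fun w => ofDisc (discAut w z)) W (𝓝 y) :=
    (W.map fun w => ofDisc (discAut w z)).le_nhds_lim
  refine ⟨y, tendsto_iff_eval.2 fun f => ?_⟩
  rw [hW] at hy
  have h1 := ((tendsto_iff_eval.1 hy f).comp hs).add (tendsto_apply_discAut_sub hdist f z)
  rw [add_zero] at h1
  exact h1.congr fun w => add_sub_cancel _ _

theorem isAnalyticMap_hoffman {m : MaxIdealSpace} (hm : m ∈ goodPoints) :
    IsAnalyticMap (hoffman m) := fun f => by
  have := discNhds_neBot hm
  obtain ⟨C, hC⟩ := exists_boundedBy f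
  obtain ⟨g, -, hg⟩ := exists_Hinf_of_tendsto (l := discNhds m) (F := fun w => compAut w f)
    (fun w => hC.compAut w) (g := fun z => hoffman m z f) fun z =>
      (tendsto_iff_eval.1 (tendsto_hoffman hm z) f).congr fun w => (compAut_apply w f z).symm
  exact ⟨g, hg⟩

/-- The composition `f ∘ L_m`. -/
def compHoffman {m : MaxIdealSpace} (hm : m ∈ goodPoints) (f : Hinf) : Hinf :=
  compHom (isAnalyticMap_hoffman hm) f

theorem compHoffman_apply {m : MaxIdealSpace} (hm : m ∈ goodPoints) (f : Hinf) (z : 𝔻) :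
    (compHoffman hm f).1 z = hoffman m z f := compHom_apply _ f z

theorem hoffmanExt_apply {m : MaxIdealSpace} (hm : m ∈ goodPoints) (ξ : MaxIdealSpace) (f : Hinf) :
    hoffmanExt m ξ f = ξ (compHoffman hm f) := extend_apply _ ξ f

theorem hoffmanExt_ofDisc {m : MaxIdealSpace} (hm : m ∈ goodPoints) (z : 𝔻) :
    hoffmanExt m (ofDisc z) = hoffman m z := extend_ofDisc (isAnalyticMap_hoffman hm) z

theorem continuous_hoffmanExt {m : MaxIdealSpace} (hm : m ∈ goodPoints) :
    Continuous (hoffmanExt m) := by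
  rw [isInducing_eval.continuous_iff, continuous_pi_iff]
  intro f
  simp only [Function.comp_apply, hoffmanExt_apply hm]
  exact continuous_eval _

theorem tendsto_compAut_compHoffman {m : MaxIdealSpace} (hm : m ∈ goodPoints) (f : Hinf) (z : 𝔻) :
    Tendsto (fun w => (compAut w f).1 z) (discNhds m) (𝓝 ((compHoffman hm f).1 z)) := by
  rw [compHoffman_apply]
  exact (tendsto_iff_eval.1 (tendsto_hoffman hm z) f).congr fun w => (compAut_apply w f z).symm

theorem hoffman_zero {m : MaxIdealSpace} (hm : m ∈ goodPoints) : hoffman m 0 = m := by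
  have := discNhds_neBot hm
  have h := tendsto_hoffman hm 0
  simp only [discAut_zero_right] at h
  exact tendsto_nhds_unique h (tendsto_ofDisc m)

theorem pure_le_discNhds (a : 𝔻) : pure a ≤ discNhds (ofDisc a) := by
  rintro U ⟨V, hV, hVU⟩
  exact hVU (show ofDisc a ∈ V from mem_of_mem_nhds hV)

theorem hoffman_ofDisc (a z : 𝔻) : hoffman (ofDisc a) z = ofDisc (discAut a z) :=
  tendsto_nhds_unique ((tendsto_hoffman (ofDisc_mem_goodPoints a) z).mono_left (pure_le_discNhds a))
    (tendsto_pure_nhds _ _)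

/-! ### Stability of the closure points of interpolating sequences under Hoffman maps -/

theorem mem_goodPoints_of_hoffmanExt {m ξ : MaxIdealSpace} (hm : m ∈ goodPoints)
    (h : hoffmanExt m ξ ∈ goodPoints) : ξ ∈ goodPoints := by
  obtain ⟨S, δ, hS, hδ, hy⟩ := exists_of_mem_goodPoints h
  have := discNhds_neBot hm
  let U := Ultrafilter.of (discNhds m)
  have hlim : ∀ z, Tendsto (fun w => (compAut w (blaschke S)).1 z) U
      (𝓝 ((compHoffman hm (blaschke S)).1 z)) := fun z =>
    (tendsto_compAut_compHoffman hm _ z).mono_left (Ultrafilter.of_le _)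
  have hsep := ZerosSeparated.of_tendsto hS.1 hδ
    (fun w => hS.zerosSeparated_blaschke.compAut w) hlim
  refine hsep.mem_goodPoints hS.lowerConst_pos hS.1 (fun z => ?_) (ξ := ξ) ?_
  · exact le_of_tendsto (hlim z).norm (Eventually.of_forall fun w =>
      (boundedBy_blaschke S).compAut w z)
  · rw [← hoffmanExt_apply, apply_blaschke_eq_zero hy]

/-- An ultrafilter containing a set with boundedly many points in each pseudohyperbolic disc of
radius `r` contains an `r`-separated subset of it. -/
theorem exists_pairwise_mem (W : Ultrafilter 𝔻) (r : ℝ) (N : ℕ) : ∀ A ∈ W,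
    (∀ s ∈ A, ∀ F : Finset 𝔻, (F : Set 𝔻) ⊆ A \ {s} → (∀ t ∈ F, pseudoDist s t < r) → F.card ≤ N) →
    ∃ T ∈ W, T ⊆ A ∧ T.Pairwise fun s t => r ≤ pseudoDist s t := by
  classical
  induction N with
  | zero =>
    refine fun A hA h => ⟨A, hA, subset_rfl, fun s hs t ht hst => ?_⟩
    by_contra! hlt
    have := h s hs {t} (by
      rw [Finset.coe_singleton, Set.singleton_subset_iff]; exact ⟨ht, hst.symm⟩)
      fun u hu => by rwa [Finset.mem_singleton.1 hu]
    rw [Finset.card_singleton] at this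
    omega
  | succ N ih =>
    intro A hA h
    obtain ⟨T, hT⟩ := zorn_subset
      {T : Set 𝔻 | T ⊆ A ∧ T.Pairwise fun s t => r ≤ pseudoDist s t} fun c hc hchain =>
        ⟨⋃₀ c, ⟨Set.sUnion_subset fun T hT => (hc hT).1,
          (Set.pairwise_sUnion hchain.directedOn).2 fun T hT => (hc hT).2⟩,
          fun T hT => Set.subset_sUnion_of_mem hT⟩
    by_cases hTW : T ∈ W
    · exact ⟨T, hTW, hT.prop.1, hT.prop.2⟩
    · have hAT : A \ T ∈ W := inter_mem hA (Ultrafilter.compl_mem_iff_notMem.2 hTW)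
      obtain ⟨T', hT'W, hT'A, hT'⟩ := ih (A \ T) hAT fun s hs F hF hFr => by
        have hex : ∃ t ∈ T, pseudoDist s t < r := by
          by_contra! hcon
          refine hs.2 (hT.le_of_ge (y := insert s T)
            ⟨Set.insert_subset hs.1 hT.prop.1, hT.prop.2.insert fun t ht _ =>
              ⟨hcon t ht, pseudoDist_comm s t ▸ hcon t ht⟩⟩ (Set.subset_insert s T)
              (Set.mem_insert s T))
        obtain ⟨t, htT, htr⟩ := hex
        have htF : t ∉ F := fun ht => (hF ht).1.2 htT
        have := h s hs.1 (insert t F) (fun u hu => by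
          rcases Finset.mem_insert.1 (Finset.mem_coe.1 hu) with rfl | hu
          · exact ⟨hT.prop.1 htT, fun hus => hs.2 (Set.mem_singleton_iff.1 hus ▸ htT)⟩
          · exact ⟨(hF hu).1.1, (hF hu).2⟩) fun u hu => by
            rcases Finset.mem_insert.1 hu with rfl | hu
            · exact htr
            · exact hFr u hu
        rw [Finset.card_insert_of_notMem htF] at this
        omega
      exact ⟨T', hT'W, hT'A.trans Set.sdiff_subset, hT'⟩

theorem one_sub_pseudoDist_discAut_left_le (s t ω : 𝔻) :
    1 - pseudoDist (discAut s ω) t ^ 2 ≤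
      (1 + ‖(ω : ℂ)‖) / (1 - ‖(ω : ℂ)‖) * (1 - pseudoDist s t ^ 2) := by
  have hω := ω.norm_lt_one
  set τ := discAut (-s) t with hτ
  have h1 : pseudoDist (discAut s ω) t = pseudoDist ω τ := by
    rw [← pseudoDist_discAut s ω τ, hτ, discAut_discAut_neg]
  have h2 : pseudoDist s t = ‖(τ : ℂ)‖ := by rw [pseudoDist_comm, pseudoDist_eq]
  rw [h1, h2, one_sub_pseudoDist_sq]
  have hτ1 := τ.sq_norm_lt_one
  have hne := norm_pos_iff.2 (one_sub_conj_mul_ne_zero τ ω.norm_lt_one)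
  have hge : 1 - ‖(ω : ℂ)‖ ≤ ‖1 - conj (τ : ℂ) * ω‖ := by
    have h3 := norm_sub_norm_le 1 (conj (τ : ℂ) * ω)
    rw [norm_one, norm_mul, RCLike.norm_conj] at h3
    have h4 := mul_le_of_le_one_left (norm_nonneg (ω : ℂ)) τ.norm_lt_one.le
    linarith
  rw [div_le_iff₀ (by positivity)]
  have h5 : (1 - ‖(ω : ℂ)‖) ^ 2 ≤ ‖1 - conj (τ : ℂ) * ω‖ ^ 2 :=
    pow_le_pow_left₀ (by linarith) hge 2
  have h6 : 0 ≤ (1 + ‖(ω : ℂ)‖) / (1 - ‖(ω : ℂ)‖) * (1 - ‖(τ : ℂ)‖ ^ 2) :=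
    mul_nonneg (div_nonneg (by positivity) (by linarith)) (by linarith)
  refine le_trans (le_of_eq ?_) (mul_le_mul_of_nonneg_left h5 h6)
  have : 1 - ‖(ω : ℂ)‖ ≠ 0 := by linarith
  field_simp
  ring

theorem one_sub_pseudoDist_discAut_le (s t ω : 𝔻) :
    1 - pseudoDist (discAut s ω) (discAut t ω) ^ 2 ≤
      ((1 + ‖(ω : ℂ)‖) / (1 - ‖(ω : ℂ)‖)) ^ 2 * (1 - pseudoDist s t ^ 2) := by
  have hω := ω.norm_lt_one
  have hK : 0 ≤ (1 + ‖(ω : ℂ)‖) / (1 - ‖(ω : ℂ)‖) := div_nonneg (by positivity) (by linarith)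
  have h1 := one_sub_pseudoDist_discAut_left_le s (discAut t ω) ω
  have h2 := one_sub_pseudoDist_discAut_left_le t s ω
  rw [pseudoDist_comm s] at h1
  rw [pseudoDist_comm t s] at h2
  refine h1.trans ((mul_le_mul_of_nonneg_left h2 hK).trans_eq (by ring))

/-- If `1 - y ^ 2` is at most a multiple of `1 - x ^ 2` and `y` is not too small, then `y` is bounded
below by a power of `x`. -/
theorem pow_le_of_one_sub_sq_le {x y C : ℝ} {n : ℕ} (hx : 0 < x) (hx1 : x ≤ 1) (hy : 0 ≤ y)
    (h1 : 1 - y ^ 2 ≤ C * (1 - x ^ 2)) (h2 : 1 - y ^ 2 ≤ 3 / 4) (hn : 4 * C ≤ n) (hC : 0 ≤ C) :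
    x ^ n ≤ y := by
  have hy2 : 1 / 4 ≤ y ^ 2 := by linarith
  have hy0 : 0 < y := hy.lt_of_ne' fun h => by rw [h] at hy2; norm_num at hy2
  have h3 : -Real.log (y ^ 2) ≤ 4 * (1 - y ^ 2) ∨ 1 ≤ y := by
    by_cases hy1 : 1 ≤ y
    · exact Or.inr hy1
    · left
      have h4 := Real.log_le_sub_one_of_pos (inv_pos.2 (pow_pos hy0 2))
      rw [Real.log_inv] at h4
      refine h4.trans ?_
      have h5 : (y ^ 2)⁻¹ ≤ 4 := by
        rw [inv_le_comm₀ (by positivity) (by norm_num)]; linarith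
      have h6 : (y ^ 2)⁻¹ - 1 = (y ^ 2)⁻¹ * (1 - y ^ 2) := by field_simp
      rw [h6]
      have h7 : y ^ 2 ≤ 1 := pow_le_one₀ hy (not_le.1 hy1).le
      exact mul_le_mul_of_nonneg_right h5 (by linarith)
  have h8 := Real.log_le_sub_one_of_pos (pow_pos hx 2)
  rw [Real.log_pow] at h3 h8
  push_cast at h3 h8
  rcases h3 with h3 | h3
  · rw [← Real.log_le_log_iff (by positivity) hy0, Real.log_pow]
    have hlx : Real.log x ≤ 0 := Real.log_nonpos hx.le hx1
    have h9 : C * (1 - x ^ 2) ≤ C * (-2 * Real.log x) :=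
      mul_le_mul_of_nonneg_left (by linarith) hC
    have h10 : 4 * C * (-Real.log x) ≤ n * (-Real.log x) :=
      mul_le_mul_of_nonneg_right hn (by linarith)
    linarith
  · exact (pow_le_one₀ hx.le hx1).trans h3

/-- The set `𝒢` is stable under Hoffman maps of its points. A point of `𝒢` is in the closure of a
uniformly separated set whose points are pseudohyperbolically far apart, and moving all of them by
the same distance keeps such a set uniformly separated. -/
theorem hoffman_mem_goodPoints {m : MaxIdealSpace} (hm : m ∈ goodPoints) (ω : 𝔻) :
    hoffman m ω ∈ goodPoints := by
  classical
  obtain ⟨S, δ, hS, hδ, hmS⟩ := exists_of_mem_goodPoints hm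
  obtain ⟨W, hW⟩ := hS.exists_ultrafilter hmS
  have hω := ω.norm_lt_one
  obtain ⟨K, hK⟩ : ∃ K, K = ((1 + ‖(ω : ℂ)‖) / (1 - ‖(ω : ℂ)‖)) ^ 2 := ⟨_, rfl⟩
  have hK1 : 1 ≤ K := by
    rw [hK]
    refine one_le_pow₀ ((one_le_div (by linarith)).2 ?_)
    linarith [norm_nonneg (ω : ℂ)]
  have hK2 : 3 / 4 / K ≤ 3 / 4 := div_le_self (by norm_num) hK1
  have hK3 : 0 < 3 / 4 / K := by positivity
  -- The radius `r` is such that `ρ(s, t) ≥ r` forces `1 - ρ(L_s(ω), L_t(ω)) ^ 2 ≤ 3 / 4`.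
  obtain ⟨r, hr⟩ : ∃ r, r = √(1 - 3 / 4 / K) := ⟨_, rfl⟩
  have hr0 : 0 ≤ r := hr ▸ Real.sqrt_nonneg _
  have hr2 : r ^ 2 = 1 - 3 / 4 / K := by rw [hr, Real.sq_sqrt (by linarith)]
  have hr1 : r < 1 := by nlinarith
  obtain ⟨N, hN⟩ := exists_pow_lt_of_lt_one hS.1 hr1
  have hSW : S ∈ W := by
    rw [← Ultrafilter.mem_coe, hW]; exact mem_inf_of_right (mem_principal_self S)
  obtain ⟨T, hTW, hTS, hT⟩ := exists_pairwise_mem W r N S hSW fun s hs F hF hFr => by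
    by_contra! hcard
    have h1 := hS.2 s hs F hF
    have h2 : ∏ t ∈ F, pseudoDist s t ≤ r ^ F.card :=
      (Finset.prod_le_prod (fun t _ => pseudoDist_nonneg s t) fun t ht =>
        (hFr t ht).le).trans_eq (Finset.prod_const r)
    have h3 := pow_le_pow_of_le_one hr0 hr1.le hcard.le
    linarith
  obtain ⟨n, hn⟩ := exists_nat_ge (4 * K)
  refine mem_goodPoints_of_mem_closure (S := (fun s => discAut s ω) '' T) (δ := δ ^ n)
    ⟨pow_pos hS.1 n, ?_⟩ ?_
  · rintro _ ⟨s, hs, rfl⟩ F hF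
    choose! p hpT hp using fun u (hu : u ∈ F) => (hF hu).1
    have hps : ∀ u ∈ F, s ≠ p u := fun u hu h => (hF hu).2 (by
      rw [Set.mem_singleton_iff, ← hp u hu, ← h])
    have hinj : Set.InjOn p F := fun u hu v hv huv => by rw [← hp u hu, ← hp v hv, huv]
    have h1 := hS.2 s (hTS hs) (F.image p) fun t ht => by
      obtain ⟨u, hu, rfl⟩ := Finset.mem_image.1 (Finset.mem_coe.1 ht)
      exact ⟨hTS (hpT u hu), (hps u hu).symm⟩
    rw [Finset.prod_image hinj] at h1
    calc δ ^ n ≤ (∏ u ∈ F, pseudoDist s (p u)) ^ n := pow_le_pow_left₀ hS.1.le h1 n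
      _ = ∏ u ∈ F, pseudoDist s (p u) ^ n := (Finset.prod_pow F n _).symm
      _ ≤ _ := Finset.prod_le_prod (fun u _ => pow_nonneg (pseudoDist_nonneg _ _) n)
          fun u hu => by
        have h2 := one_sub_pseudoDist_discAut_le s (p u) ω
        have hpu : discAut (p u) ω = u := hp u hu
        rw [← hK, hpu] at h2
        refine pow_le_of_one_sub_sq_le (pseudoDist_pos (hps u hu)) (pseudoDist_lt_one _ _).le
          (pseudoDist_nonneg _ _) h2 (h2.trans ?_) hn (by linarith)
        have h3 := pow_le_pow_left₀ hr0 (hT hs (hpT u hu) (hps u hu)) 2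
        calc K * (1 - pseudoDist s (p u) ^ 2) ≤ K * (3 / 4 / K) := by
              gcongr; linarith
          _ = 3 / 4 := by field_simp
  · have hlim := (tendsto_hoffman hm ω).mono_left
      (show (W : Filter 𝔻) ≤ discNhds m from hW ▸ inf_le_left)
    refine mem_closure_of_tendsto hlim ?_
    filter_upwards [hTW] with s hs using ⟨_, ⟨s, hs, rfl⟩, rfl⟩

/-! ### The function `λ` -/

theorem lamApprox_eq_circleExp (m : MaxIdealSpace) (w : 𝔻) :
    lamApprox m w = Circle.exp (2 * arg (1 + conj (proj m) * w)) := by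
  apply Circle.coe_injective
  rw [coe_lamApprox, Circle.coe_exp]
  have hv := one_add_conj_mul_ne_zero (norm_proj_le m) w.norm_lt_one
  have hconj : 1 + proj m * conj (w : ℂ) = conj (1 + conj (proj m) * w) := by simp
  rw [hconj]
  generalize 1 + conj (proj m) * (w : ℂ) = v at *
  rw [div_eq_iff ((map_ne_zero _).2 hv)]
  have h1 : conj v = ‖v‖ * Complex.exp (-(arg v * I)) := by
    conv_lhs => rw [← norm_mul_exp_arg_mul_I v]
    rw [map_mul, conj_ofReal, ← exp_conj, map_mul, conj_ofReal, conj_I, mul_neg]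
  rw [h1, mul_left_comm, ← Complex.exp_add]
  conv_lhs => rw [← norm_mul_exp_arg_mul_I v]
  congr 2
  push_cast
  ring

/-- The limit defining `λ(m, x)` exists: the function `exp (i log (1 + conj π(m) * w))` is an
invertible element of `H^∞` whose modulus determines the argument of `1 + conj π(m) * w`. -/
theorem tendsto_lamApprox (m x : MaxIdealSpace) :
    Tendsto (lamApprox m) (discNhds x) (𝓝 (lam m x)) := by
  refine tendsto_nhds_limUnder ?_
  have hp := norm_proj_le m
  have hslit : ∀ z : ℂ, ‖z‖ < 1 → 1 + conj (proj m) * z ∈ slitPlane := fun z hz => by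
    refine mem_slitPlane_of_norm_lt_one ?_
    rw [norm_mul, RCLike.norm_conj]
    exact (mul_le_of_le_one_left (norm_nonneg z) hp).trans_lt hz
  have hnorm : ∀ z : 𝔻, ‖Complex.exp (I * Complex.log (1 + conj (proj m) * z))‖ =
      Real.exp (-arg (1 + conj (proj m) * z)) := fun z => by
    rw [norm_exp, I_mul_re, log_im]
  obtain ⟨f, -, hf⟩ := exists_Hinf
    (G := fun z => Complex.exp (I * Complex.log (1 + conj (proj m) * z))) (C := Real.exp Real.pi)
    ((DifferentiableOn.clog ((differentiableOn_id.const_mul _).const_add _) fun z hz =>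
      hslit z (mem_ball_zero_iff.1 hz)).const_mul I).cexp fun z => by
      rw [hnorm]
      exact Real.exp_le_exp.2 (by linarith [neg_pi_lt_arg (1 + conj (proj m) * (z : ℂ))])
  obtain ⟨f', hf'⟩ := exists_inverse (k := f) (Real.exp_pos (-Real.pi)) fun z => by
    rw [hf, hnorm]
    exact Real.exp_le_exp.2 (by linarith [arg_le_pi (1 + conj (proj m) * (z : ℂ))])
  have hxf : x f ≠ 0 := fun h0 => by
    have := congrArg x hf'
    rw [map_mul, h0, zero_mul, map_one] at this
    exact zero_ne_one this
  refine ⟨Circle.exp (2 * -Real.log ‖x f‖), ?_⟩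
  have hlog : Tendsto (fun w => 2 * -Real.log ‖f.1 w‖) (discNhds x)
      (𝓝 (2 * -Real.log ‖x f‖)) :=
    ((tendsto_apply_discNhds x f).norm.log (norm_ne_zero_iff.2 hxf)).neg.const_mul 2
  refine ((Circle.exp.continuous.tendsto _).comp hlog).congr fun w => ?_
  rw [Function.comp_apply, hf, hnorm, Real.log_exp, neg_neg, lamApprox_eq_circleExp]

theorem lam_ofDisc (m : MaxIdealSpace) (a : 𝔻) : lam m (ofDisc a) = lamApprox m a :=
  tendsto_nhds_unique ((tendsto_lamApprox m (ofDisc a)).mono_left (pure_le_discNhds a))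
    (tendsto_pure_nhds _ _)

/-- The approximation of `λ` is jointly continuous. -/
theorem tendsto_lamApprox_of_tendsto {ι : Type*} {l : Filter ι} {x : ι → MaxIdealSpace} {u : ι → 𝔻}
    {x₀ : MaxIdealSpace} {u₀ : 𝔻} (hx : Tendsto x l (𝓝 x₀)) (hu : Tendsto u l (𝓝 u₀)) :
    Tendsto (fun i => lamApprox (x i) (u i)) l (𝓝 (lamApprox x₀ u₀)) := by
  rw [← tendsto_circle_coe_iff]
  rw [← tendsto_coe_iff] at hu
  have hp : Tendsto (fun i => proj (x i)) l (𝓝 (proj x₀)) := tendsto_iff_eval.1 hx coordFun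
  simp only [coe_lamApprox]
  refine ((((continuous_conj.tendsto _).comp hp).mul hu).const_add 1).div
    ((hp.mul ((continuous_conj.tendsto _).comp hu)).const_add 1) ?_
  exact one_add_mul_conj_ne_zero (norm_proj_le x₀) u₀.norm_lt_one

theorem lamApprox_mul_eq {x₁ x₂ x₃ x₄ : MaxIdealSpace} {u₁ u₂ u₃ u₄ : 𝔻}
    (h : (1 + conj (proj x₁) * u₁) * (1 + conj (proj x₂) * u₂) =
      (1 + conj (proj x₃) * u₃) * (1 + conj (proj x₄) * u₄)) :
    lamApprox x₁ u₁ * lamApprox x₂ u₂ = lamApprox x₃ u₃ * lamApprox x₄ u₄ := by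
  apply Circle.coe_injective
  have h' := congrArg conj h
  simp only [map_mul, map_add, map_one, conj_conj] at h'
  rw [Circle.coe_mul, Circle.coe_mul, coe_lamApprox, coe_lamApprox, coe_lamApprox, coe_lamApprox,
    div_mul_div_comm, div_mul_div_comm, h, h']

theorem proj_hoffman {m : MaxIdealSpace} (hm : m ∈ goodPoints) (v : 𝔻) :
    proj (hoffman m v) = ((v : ℂ) + proj m) / (1 + conj (proj m) * v) := by
  have := discNhds_neBot hm
  have h := tendsto_iff_eval.1 (tendsto_hoffman hm v) coordFun
  have hp : Tendsto (fun w : 𝔻 => (w : ℂ)) (discNhds m) (𝓝 (proj m)) :=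
    tendsto_apply_discNhds m coordFun
  refine tendsto_nhds_unique h ?_
  exact (hp.const_add _).div ((((continuous_conj.tendsto _).comp hp).mul_const _).const_add 1)
    (one_add_conj_mul_ne_zero (norm_proj_le m) v.norm_lt_one)

/-- The cocycle identity for `λ`, which expresses that composition of the maps `L` is associative. -/
theorem lamApprox_cocycle {m : MaxIdealSpace} (hm : m ∈ goodPoints) (v a : 𝔻) :
    lamApprox m (discAut v a) * lamApprox (ofDisc v) a =
      lamApprox m v * lamApprox (hoffman m v) ((lamApprox m v)⁻¹ • a) := by
  apply lamApprox_mul_eq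
  have h1 := one_add_conj_mul_ne_zero (norm_proj_le m) v.norm_lt_one
  have h2 := one_add_mul_conj_ne_zero (norm_proj_le m) v.norm_lt_one
  have h3 := one_add_conj_mul_ne_zero v.norm_lt_one.le a.norm_lt_one
  rw [proj_hoffman hm, UnitDisc.coe_circle_smul, Circle.coe_inv, coe_lamApprox, coe_discAut,
    proj_ofDisc]
  simp only [map_div₀, map_add, map_mul, map_one, conj_conj]
  generalize conj (v : ℂ) = v' at *
  generalize conj (proj m) = p' at *
  have e1 : (1 + p' * (((a : ℂ) + v) / (1 + v' * a))) * (1 + v' * a) =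
      (1 + v' * a) + p' * (a + v) := by
    rw [add_mul, one_mul, mul_assoc, div_mul_cancel₀ _ h3]
  rw [e1, inv_div]
  have e2 : (v' + p') / (1 + proj m * v') * ((1 + proj m * v') / (1 + p' * v) * (a : ℂ)) =
      (v' + p') * a / (1 + p' * v) := by
    rw [← mul_assoc, div_mul_div_cancel₀ h2, div_mul_eq_mul_div]
  rw [e2, mul_add (1 + p' * (v : ℂ)) 1, mul_div_cancel₀ _ h1]
  ring

theorem lamApprox_self_neg (v : 𝔻) : lamApprox (ofDisc v) (-v) = 1 := by
  apply Circle.coe_injective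
  rw [coe_lamApprox, Circle.coe_one, div_eq_one_iff_eq]
  · simp [mul_comm]
  · exact one_add_mul_conj_ne_zero (norm_proj_le _) (-v).norm_lt_one

theorem lamApprox_zero (m : MaxIdealSpace) : lamApprox m 0 = 1 := by
  apply Circle.coe_injective
  simp [coe_lamApprox]

/-! ### Composition of Hoffman maps -/

/-- The composition law `L_m(L_x(λ(m, x) z)) = L_{L_m(x)}(z)`, the limit of the composition law of
the disc automorphisms. -/
theorem hoffmanExt_hoffman {m x : MaxIdealSpace} (hm : m ∈ goodPoints) (hx : x ∈ goodPoints)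
    (hy : hoffmanExt m x ∈ goodPoints) (z : 𝔻) :
    hoffmanExt m (hoffman x (lam m x • z)) = hoffman (hoffmanExt m x) z := by
  refine CharacterSpace.ext fun f => ?_
  have := discNhds_neBot hm
  have := discNhds_neBot hx
  obtain ⟨C, hC⟩ := exists_boundedBy f
  obtain ⟨D, hD⟩ := exists_boundedBy (compHoffman hm f)
  rw [hoffmanExt_apply hm]
  set y := hoffmanExt m x
  have h1 : Tendsto (fun u => (compAut u (compHoffman hm f)).1 (lamApprox m u • z)) (discNhds x)
      (𝓝 (hoffman x (lam m x • z) (compHoffman hm f))) :=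
    tendsto_apply_of_tendsto (fun u => hD.compAut u)
      (tendsto_circle_smul (tendsto_lamApprox m x) tendsto_const_nhds)
      ((tendsto_iff_eval.1 (tendsto_hoffman hx _) _).congr fun u => (compAut_apply _ _ _).symm)
  refine tendsto_nhds_unique h1 (Metric.nhds_basis_closedBall.tendsto_right_iff.2 fun ε hε => ?_)
  obtain ⟨V, hV, hVf⟩ := (tendsto_iff_eval.1 (tendsto_hoffman hy z) f)
    (Metric.closedBall_mem_nhds _ hε)
  obtain ⟨V', hV'V, hV'o, hyV'⟩ := mem_nhds_iff.1 hV
  have hlim : Tendsto (fun u => hoffmanExt m (ofDisc u)) (discNhds x) (𝓝 y) :=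
    ((continuous_hoffmanExt hm).tendsto x).comp (tendsto_ofDisc x)
  filter_upwards [hlim.eventually (hV'o.mem_nhds hyV')] with u hu
  rw [hoffmanExt_ofDisc hm] at hu
  have hpts : Tendsto (fun w => discAut u (lamApprox (ofDisc w) u • z)) (discNhds m)
      (𝓝 (discAut u (lamApprox m u • z))) :=
    tendsto_discAut tendsto_const_nhds (tendsto_circle_smul
      (tendsto_lamApprox_of_tendsto (tendsto_ofDisc m) tendsto_const_nhds) tendsto_const_nhds)
  have h2 := tendsto_apply_of_tendsto (F := fun w => compAut w f) (fun w => hC.compAut w) hpts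
    (tendsto_compAut_compHoffman hm f _)
  rw [compAut_apply]
  refine Metric.isClosed_closedBall.mem_of_tendsto h2 ?_
  filter_upwards [(tendsto_hoffman hm u).eventually (hV'o.mem_nhds hu)] with w hw
  rw [compAut_apply, discAut_discAut_smul]
  exact hVf (hV'V hw)

/-- The composition law at a point of the disc, solved for the value at the origin. -/
theorem hoffman_hoffman_smul_neg {m : MaxIdealSpace} (hm : m ∈ goodPoints) (a : 𝔻) :
    hoffman (hoffman m a) ((lamApprox m a)⁻¹ • (-a)) = m := by
  have h := hoffmanExt_hoffman hm (ofDisc_mem_goodPoints a)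
    (by rw [hoffmanExt_ofDisc hm]; exact hoffman_mem_goodPoints hm a) ((lamApprox m a)⁻¹ • (-a))
  rw [hoffmanExt_ofDisc hm, lam_ofDisc, smul_inv_smul, hoffman_ofDisc, discAut_self_neg,
    hoffmanExt_ofDisc hm, hoffman_zero hm] at h
  exact h.symm

/-- The limit of the cocycle identity for `λ`. -/
theorem lam_hoffman_mul {m ξ : MaxIdealSpace} (hm : m ∈ goodPoints) (hξ : ξ ∈ goodPoints) (a : 𝔻) :
    lam m (hoffman ξ a) * lamApprox ξ a =
      lam m ξ * lamApprox (hoffmanExt m ξ) ((lam m ξ)⁻¹ • a) := by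
  have := discNhds_neBot hξ
  have h1 : Tendsto (fun v => lamApprox m (discAut v a) * lamApprox (ofDisc v) a) (discNhds ξ)
      (𝓝 (lam m (hoffman ξ a) * lamApprox ξ a)) :=
    ((tendsto_lamApprox m _).comp (tendsto_discNhds_iff.2 (tendsto_hoffman hξ a))).mul
      (tendsto_lamApprox_of_tendsto (tendsto_ofDisc ξ) tendsto_const_nhds)
  have h2 : Tendsto (fun v => lamApprox m v *
      lamApprox (hoffmanExt m (ofDisc v)) ((lamApprox m v)⁻¹ • a)) (discNhds ξ)
      (𝓝 (lam m ξ * lamApprox (hoffmanExt m ξ) ((lam m ξ)⁻¹ • a))) :=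
    (tendsto_lamApprox m ξ).mul (tendsto_lamApprox_of_tendsto
      (((continuous_hoffmanExt hm).tendsto ξ).comp (tendsto_ofDisc ξ))
      (tendsto_circle_smul (tendsto_lamApprox m ξ).inv tendsto_const_nhds))
  refine tendsto_nhds_unique h1 (h2.congr fun v => ?_)
  rw [hoffmanExt_ofDisc hm, ← lamApprox_cocycle hm]

theorem lamApprox_hoffman_smul_neg {m : MaxIdealSpace} (hm : m ∈ goodPoints) (ω : 𝔻) :
    lamApprox (hoffman m ω) ((lamApprox m ω)⁻¹ • (-ω)) = (lamApprox m ω)⁻¹ := by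
  have h := lamApprox_cocycle hm ω (-ω)
  rw [discAut_self_neg, lamApprox_zero, lamApprox_self_neg, one_mul] at h
  exact eq_inv_of_mul_eq_one_right h.symm

end HoffmanMaps

end

theorem lemma2p1 (m : HoffmanMaps.MaxIdealSpace) (hm : m ∈ HoffmanMaps.goodPoints) (ω : 𝔻) :
    HoffmanMaps.saturation m (HoffmanMaps.ofDisc ω) =
      {ξ | ∃ x ∈ HoffmanMaps.saturation m (HoffmanMaps.ofDisc 0),
        ξ = HoffmanMaps.hoffman x (HoffmanMaps.lam m x • ω)} := by
  open HoffmanMaps in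
  ext ξ
  simp only [saturation, Set.mem_preimage, Set.mem_singleton_iff, Set.mem_ofPred_eq,
    hoffmanExt_ofDisc hm, hoffman_zero hm]
  constructor
  · intro hξ
    have hy : hoffmanExt m ξ ∈ goodPoints := hξ ▸ hoffman_mem_goodPoints hm ω
    have hξG : ξ ∈ goodPoints := mem_goodPoints_of_hoffmanExt hm hy
    -- The point `z` satisfies `L_{L_m(ω)}(z) = m`, so that `x = L_ξ(λ(m, ξ) z)` is in the fiber.
    let z : 𝔻 := (lamApprox m ω)⁻¹ • (-ω)
    let a : 𝔻 := lam m ξ • z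
    have hx : hoffmanExt m (hoffman ξ a) = m := by
      rw [hoffmanExt_hoffman hm hξG hy, hξ]
      exact hoffman_hoffman_smul_neg hm ω
    refine ⟨hoffman ξ a, hx, ?_⟩
    have hlam : lam m (hoffman ξ a) * lamApprox ξ a = lam m ξ * (lamApprox m ω)⁻¹ := by
      rw [lam_hoffman_mul hm hξG, inv_smul_smul, hξ, lamApprox_hoffman_smul_neg hm]
    have hpt : lam m (hoffman ξ a) • ω = (lamApprox ξ a)⁻¹ • (-a) := by
      have hneg : -a = (lam m ξ * (lamApprox m ω)⁻¹) • ω := by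
        apply Complex.UnitDisc.coe_injective
        simp only [a, z, Complex.UnitDisc.coe_neg, Complex.UnitDisc.coe_circle_smul, Circle.coe_mul]
        ring
      rw [hneg, smul_smul, ← hlam, mul_comm (lam m (hoffman ξ a)), inv_mul_cancel_left]
    rw [hpt, hoffman_hoffman_smul_neg hξG]
  · rintro ⟨x, hx, rfl⟩
    have hy : hoffmanExt m x ∈ goodPoints := hx.symm ▸ hm
    rw [hoffmanExt_hoffman hm (mem_goodPoints_of_hoffmanExt hm hy) hy, hx]
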